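/- **Definitions.** Let $W$ be a finite-dimensional vector space over a field $K$, $U=W^*$ its dual, and $\mathcal{H}$ a finite set of (linear) hyperplanes of $W$. The intersection lattice $L=L(\mathcal{H})$ is the set of all intersections of members of $\mathcal{H}$ (including the empty intersection $W$), ordered by reverse inclusion; its least element is $0=W$, its atoms are the $H\in\mathcal{H}$, its rank function $\operatorname{rk}$ is the codimension, and we put $n=\operatorname{rk} L=\operatorname{codim}\bigcap_{H\in\mathcal{H}}H$. Write $y\prec x$ if $x$ covers $y$. For $x\in L$, the *restriction* $\mathcal{H}_{\ge x}$ is the arrangement $\{H\cap x : H\in\mathcal{H},\ H\not\supset x\}$ in the vector space $x$. The *relation complex* of $\mathcal{H}$ is the chain complex $0\to V_n\to\dots\to V_1\xrightarrow{\partial_1} V_0$ with $V_i=\bigoplus_{\operatorname{rk}(x)=i}V_x$ defined inductively by: the piece of the least element of $L$ is $V_0=U$; $V_H=H^\perp\subset U$ for $H\in\mathcal{H}$, with $\partial_1|_{V_H}$ the inclusion; and for $\operatorname{rk}(x)=i\ge 2$, $V_x$ is the kernel of $\partial_{i-1}$ on $\bigoplus_{y\prec x}V_y$, with $\partial_i|_{V_x}$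 the inclusion into $\bigoplus_{y\prec x}V_y$. For $x\in L$ let $V_{\le x}=\bigoplus_{y\le x}V_y$ be the subcomplex, graded by $L_{\le x}=\{y\in L: y\le x\}$. An *$L_{\le x}$-homotopy* of $V_{\le x}$ consists of linear maps $d_0:\operatorname{Im}\partial_1\to (V_{\le x})_1$ and $d_i:(V_{\le x})_i\to (V_{\le x})_{i+1}$ for $i\ge 1$ (all $\partial_j$ being restricted to $V_{\le x}$) such that $d_{i-1}\partial_i+\partial_{i+1}d_i=\operatorname{id}$ on $(V_{\le x})_i$ for all $i\ge 1$, and $d_{\operatorname{rk}(y)}(V_y)\subset\bigoplus_{y\prec z\le x}V_z$ for all $y\in L_{\le x}\setminus\{0\}$. The relation complex is *$L$-contractible* if $V_{\le x}$ admits an $L_{\le x}$-homotopy for every $x\in L$. The arrangement is *$k$-formal* if $\operatorname{Ker}\partial_i=\operatorname{Im}\partial_{i+1}$ for $1\le i\le k-1$, and the complex is *acyclic* if this holds for all $i\ge 1$. **Theorem.** Let $E$ be a finite-dimensional complex vector space, $G\subset GL(E)$ a finite group generated by complex reflections (elements of finite order whose fixed space is a hyperplane), and $\mathcal{H}$ the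 arrangement of the reflecting hyperplanes of all complex reflections in $G$. Let $X$ be any element of the intersection lattice of $\mathcal{H}$ ($X=E$ is allowed). Then the relation complex of the restriction $\mathcal{H}_{\ge X}$ is $L$-contractible, where $L$ is the intersection lattice of $\mathcal{H}_{\ge X}$. Consequently this relation complex is acyclic; in particular $\mathcal{H}_{\ge X}$ is $n$-formal, where $n$ is the rank of $\mathcal{H}_{\ge X}$. -/

import Mathlib

noncomputable section

open scoped Classical

universe u v w

namespace LGraded

attribute [local instance] Fintype.ofFinite

/-! Complexes graded by a finite geometric lattice `L`. The definitions use only the order of `L`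
and its least element. -/

/-- The rank of an element `x`: the length of a longest chain with largest element `x`. -/
def rk {L : Type u} [PartialOrder L] (x : L) : ℕ := (Order.height x).toNat

/-- A chain complex of `R`-modules with a compatible `L`-grading, given by its graded pieces `V_x`
and by the components `V_x → V_y` of the boundary map. The component is zero unless `x` covers `y`,
and the square of the boundary map is zero. The chain module `V_i` is the direct sum of the `V_x`
with `rk x = i`, see `chain`. -/
structure GradedComplex (R : Type w) [Ring R] (L : Type u) [PartialOrder L] [Finite L] where
  piece : L → Type v
  [addCommGroup : ∀ x : L, AddCommGroup (piece x)]
  [module : ∀ x : L, Module R (piece x)]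
  bd : ∀ x y : L, piece x →ₗ[R] piece y
  bd_eq_zero : ∀ x y : L, ¬ y ⋖ x → bd x y = 0
  bd_comp : ∀ x z : L, ∑ y : L, bd y z ∘ₗ bd x y = 0

namespace GradedComplex

variable {R : Type w} [Ring R] {L : Type u} [PartialOrder L] [Finite L]

attribute [instance] GradedComplex.addCommGroup GradedComplex.module

/-- The module `V_i`, the direct sum of the pieces `V_x` with `rk x = i`. -/
abbrev chain (V : GradedComplex.{u, v, w} R L) (i : ℕ) : Type (max u v) :=
  ∀ x : {x : L // rk x = i}, V.piece x.1

/-- The boundary map `V_{i+1} → V_i`. -/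
def d (V : GradedComplex.{u, v, w} R L) (i : ℕ) : V.chain (i + 1) →ₗ[R] V.chain i :=
  LinearMap.pi fun y => ∑ x : {x : L // rk x = i + 1},
    V.bd x.1 y.1 ∘ₗ LinearMap.proj (R := R) (φ := fun x : {x : L // rk x = i + 1} => V.piece x.1) x

/-- The subcomplex `V_{≤ x}`, the sum of the `V_y` with `y ≤ x`, graded by the lower interval
`L_{≤ x}`. -/
def below (V : GradedComplex.{u, v, w} R L) (x : L) : GradedComplex.{u, v, w} R (Set.Iic x) where
  piece y := V.piece y.1
  bd y z := V.bd y.1 z.1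
  bd_eq_zero y z h := V.bd_eq_zero _ _ fun h' =>
    h ⟨h'.lt, fun c hc hc' => h'.2 (c := c.1) hc hc'⟩
  bd_comp y z := by
    rw [← V.bd_comp y.1 z.1]
    convert (Fintype.sum_of_injective (Subtype.val : Set.Iic x → L) Subtype.val_injective
      (fun t => V.bd t.1 z.1 ∘ₗ V.bd y.1 t.1) (fun t => V.bd t z.1 ∘ₗ V.bd y.1 t) ?_ ?_)
    · intro t ht
      rw [V.bd_eq_zero y.1 t, LinearMap.comp_zero]
      intro h
      exact ht ⟨⟨t, h.le.trans y.2⟩, rfl⟩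
    · intro t
      rfl

/-- `Ker ∂_i = Im ∂_{i+1}` for all `i ≥ 1`. -/
def IsAcyclic (V : GradedComplex.{u, v, w} R L) : Prop :=
  ∀ i : ℕ, LinearMap.ker (V.d i) = LinearMap.range (V.d (i + 1))

/-- `Ker ∂_i = Im ∂_{i+1}` for `i = 1, …, k - 1`. -/
def IsFormal (V : GradedComplex.{u, v, w} R L) (k : ℕ) : Prop :=
  ∀ i : ℕ, i + 1 < k → LinearMap.ker (V.d i) = LinearMap.range (V.d (i + 1))

/-- An `L`-homotopy: a contracting homotopy `h₀ : Im ∂_1 → V_1`, `h i : V_{i+1} → V_{i+2}`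
that maps `V_x` to the sum of the `V_y` with `y` covering `x`, for all `x ≠ 0`. -/
structure LHomotopy (V : GradedComplex.{u, v, w} R L) where
  h₀ : LinearMap.range (V.d 0) →ₗ[R] V.chain 1
  h : ∀ i : ℕ, V.chain (i + 1) →ₗ[R] V.chain (i + 2)
  homotopy_one : h₀ ∘ₗ (V.d 0).rangeRestrict + V.d 1 ∘ₗ h 0 = LinearMap.id
  homotopy_succ : ∀ i : ℕ, h i ∘ₗ V.d (i + 1) + V.d (i + 2) ∘ₗ h (i + 1) = LinearMap.id
  graded : ∀ (i : ℕ) (x : {x : L // rk x = i + 1}) (y : {y : L // rk y = i + 2})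
    (v : V.piece x.1), ¬ x.1 ⋖ y.1 → h i (Pi.single x v) y = 0

/-- `V` is `L`-contractible if every `V_{≤ x}` admits an `L`-homotopy. -/
def IsLContractible (V : GradedComplex.{u, v, w} R L) : Prop :=
  ∀ x : L, Nonempty (LHomotopy (V.below x))

end GradedComplex

/-- An atomic datum on the module `M`: a submodule `U_a` of `M` for each atom `a` of `L`. -/
structure AtomicDatum (R : Type w) [Ring R] (L : Type u) [PartialOrder L] [OrderBot L]
    (M : Type v) [AddCommGroup M] [Module R M] where
  sub : ∀ a : L, IsAtom a → Submodule R M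

/-- `V` is a minimal complex of the atomic datum `D`: up to isomorphism `V_0` is `M`, the
piece `V_a` of an atom is `U_a` with `∂_a` the inclusion, and for the remaining `x` the
boundary map identifies `V_x` with the kernel of `∂` on the sum of the `V_y`, `y` covered by `x`. -/
structure GradedComplex.IsMinimal {R : Type w} [Ring R] {L : Type u} [PartialOrder L] [OrderBot L]
    [Finite L] {M : Type v} [AddCommGroup M] [Module R M] (V : GradedComplex.{u, max u v, w} R L)
    (D : AtomicDatum R L M) : Prop where
  low : ∃ e : V.piece ⊥ ≃ₗ[R] M, ∀ (a : L) (ha : IsAtom a),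
    ∃ f : V.piece a ≃ₗ[R] D.sub a ha, ∀ v, e (V.bd a ⊥ v) = f v
  injective : ∀ x : L, x ≠ ⊥ → ¬ IsAtom x → ∀ v : V.piece x, (∀ y, V.bd x y v = 0) → v = 0
  exact : ∀ x : L, x ≠ ⊥ → ¬ IsAtom x → ∀ f : (∀ y, V.piece y), (∀ y, ¬ y ⋖ x → f y = 0) →
    (∀ z, ∑ y : L, V.bd y z (f y) = 0) → ∃ v : V.piece x, ∀ y, V.bd x y v = f y

/-- The `y`-component of a function on lists, see `minimalPiece`. -/
def shift (R : Type w) [Ring R] {L : Type u} {M : Type v} [AddCommGroup M] [Module R M] (y : L) :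
    (List L → M) →ₗ[R] (List L → M) :=
  LinearMap.funLeft R M (List.cons y)

theorem shift_single_nil (R : Type w) [Ring R] {L : Type u} {M : Type v} [AddCommGroup M] [Module R M]
    (y : L) (m : M) : shift R y (Pi.single [] m : List L → M) = 0 := by
  ext c
  simp [shift, LinearMap.funLeft]

theorem shift_single_cons (R : Type w) [Ring R] {L : Type u} {M : Type v} [AddCommGroup M]
    [Module R M] (x y : L) (m : M) :
    shift R y (Pi.single [x] m : List L → M) = if y = x then Pi.single [] m else 0 := by
  ext c
  by_cases h : y = x <;> simp [shift, LinearMap.funLeft, h, Pi.single_apply]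

section Minimal

variable {R : Type w} [Ring R] {L : Type u} [PartialOrder L] [OrderBot L] [Finite L]
  {M : Type v} [AddCommGroup M] [Module R M]

/-- The graded pieces of the minimal complex, by recursion over `x`. All of them are realized in
the module of functions `List L → M`: the element `(v_y)` of the sum of the `V_y` is the
function `v` with `v [] = 0` and `v (y :: c) = v_y c`. Thus `V_0` is `M`, as the functions that
vanish off `[]`; `V_a` is `U_a` for an atom `a`, with the only component in `V_0`; any other `V_x`
is the kernel of the boundary map on the sum of the `V_y`, `y` covered by `x`. -/
def minimalPiece (D : AtomicDatum R L M) : L → Submodule R (List L → M) :=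
  (wellFounded_lt (α := L)).fix fun x V =>
    if x = ⊥ then
      LinearMap.range (LinearMap.single R (fun _ : List L => M) [])
    else if hx : IsAtom x then
      (D.sub x hx).map (LinearMap.single R (fun _ : List L => M) [⊥])
    else
      LinearMap.ker (LinearMap.proj (R := R) (φ := fun _ : List L => M) []) ⊓
      (⨅ (y : L) (hy : y ⋖ x), (V y hy.lt).comap (shift R y)) ⊓
      (⨅ (y : L) (_ : ¬ y ⋖ x), LinearMap.ker (shift R y)) ⊓
      ⨅ z : L, LinearMap.ker (∑ y : L, shift R z ∘ₗ shift (M := M) R y)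

theorem minimalPiece_eq (D : AtomicDatum R L M) (x : L) : minimalPiece D x =
    if x = ⊥ then
      LinearMap.range (LinearMap.single R (fun _ : List L => M) [])
    else if hx : IsAtom x then
      (D.sub x hx).map (LinearMap.single R (fun _ : List L => M) [⊥])
    else
      LinearMap.ker (LinearMap.proj (R := R) (φ := fun _ : List L => M) []) ⊓
      (⨅ (y : L) (_ : y ⋖ x), (minimalPiece D y).comap (shift R y)) ⊓
      (⨅ (y : L) (_ : ¬ y ⋖ x), LinearMap.ker (shift R y)) ⊓
      ⨅ z : L, LinearMap.ker (∑ y : L, shift R z ∘ₗ shift (M := M) R y) := by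
  unfold minimalPiece
  rw [WellFounded.fix_eq]

theorem mem_minimalPiece_bot (D : AtomicDatum R L M) (v : List L → M) :
    v ∈ minimalPiece D ⊥ ↔ ∃ m : M, Pi.single [] m = v := by
  rw [minimalPiece_eq, if_pos rfl]
  rfl

theorem mem_minimalPiece_atom (D : AtomicDatum R L M) {a : L} (ha : IsAtom a) (v : List L → M) :
    v ∈ minimalPiece D a ↔ ∃ m ∈ D.sub a ha, Pi.single [⊥] m = v := by
  rw [minimalPiece_eq, if_neg ha.1, dif_pos ha]
  rfl

theorem mem_minimalPiece (D : AtomicDatum R L M) {x : L} (hx : x ≠ ⊥) (hx' : ¬ IsAtom x)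
    (v : List L → M) : v ∈ minimalPiece D x ↔ v [] = 0 ∧
      (∀ y, y ⋖ x → shift R y v ∈ minimalPiece D y) ∧ (∀ y, ¬ y ⋖ x → shift R y v = 0) ∧
      ∀ z, ∑ y : L, shift R z (shift R y v) = 0 := by
  rw [minimalPiece_eq, if_neg hx, dif_neg hx']
  simp [Submodule.mem_iInf, and_assoc]

theorem shift_eq_zero (D : AtomicDatum R L M) {x y : L} (h : ¬ y ⋖ x) {v : List L → M}
    (hv : v ∈ minimalPiece D x) : shift R y v = 0 := by
  by_cases hx : x = ⊥
  · subst hx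
    obtain ⟨m, rfl⟩ := (mem_minimalPiece_bot D v).1 hv
    exact shift_single_nil R y m
  by_cases hx' : IsAtom x
  · obtain ⟨m, -, rfl⟩ := (mem_minimalPiece_atom D hx' v).1 hv
    rw [shift_single_cons, if_neg]
    rintro rfl
    exact h (bot_covBy_iff.2 hx')
  · exact ((mem_minimalPiece D hx hx' v).1 hv).2.2.1 y h

theorem shift_mem (D : AtomicDatum R L M) {x y : L} (h : y ⋖ x) {v : List L → M}
    (hv : v ∈ minimalPiece D x) : shift R y v ∈ minimalPiece D y := by
  have hx : x ≠ ⊥ := h.lt.ne_bot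
  by_cases hx' : IsAtom x
  · have hy : y = ⊥ := hx'.2 y h.lt
    subst hy
    obtain ⟨m, -, rfl⟩ := (mem_minimalPiece_atom D hx' v).1 hv
    rw [shift_single_cons, if_pos rfl, mem_minimalPiece_bot]
    exact ⟨m, rfl⟩
  · exact ((mem_minimalPiece D hx hx' v).1 hv).2.1 y h

theorem shift_mem' (D : AtomicDatum R L M) (x y : L) {v : List L → M}
    (hv : v ∈ minimalPiece D x) : shift R y v ∈ minimalPiece D y := by
  by_cases h : y ⋖ x
  · exact shift_mem D h hv
  · rw [shift_eq_zero D h hv]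
    exact zero_mem _

theorem sum_shift_eq_zero (D : AtomicDatum R L M) (x z : L) {v : List L → M}
    (hv : v ∈ minimalPiece D x) : ∑ y : L, shift R z (shift R y v) = 0 := by
  by_cases hx : x = ⊥
  · subst hx
    refine Finset.sum_eq_zero fun y _ => ?_
    rw [shift_eq_zero D (fun h => not_lt_bot h.lt) hv, map_zero]
  by_cases hx' : IsAtom x
  · obtain ⟨m, -, rfl⟩ := (mem_minimalPiece_atom D hx' v).1 hv
    refine Finset.sum_eq_zero fun y _ => ?_
    rw [shift_single_cons]
    split_ifs
    · exact shift_single_nil R z m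
    · exact map_zero _
  · exact ((mem_minimalPiece D hx hx' v).1 hv).2.2.2 z

/-- The minimal complex of an atomic datum. -/
def minimalComplex (D : AtomicDatum R L M) : GradedComplex.{u, max u v, w} R L where
  piece x := minimalPiece D x
  bd x y := (shift R y).restrict fun _ hv => shift_mem' D x y hv
  bd_eq_zero x y h := by
    ext1 v
    exact Subtype.ext (shift_eq_zero D h v.2)
  bd_comp x z := by
    ext1 v
    apply Subtype.ext
    simpa [LinearMap.sum_apply] using sum_shift_eq_zero D x z v.2

theorem minimalComplex_isMinimal (D : AtomicDatum R L M) : (minimalComplex D).IsMinimal D where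
  low := by
    refine ⟨LinearEquiv.ofBijective
      (LinearMap.proj (R := R) (φ := fun _ : List L => M) [] ∘ₗ (minimalPiece D ⊥).subtype)
      ⟨?_, fun m => ⟨⟨Pi.single [] m, (mem_minimalPiece_bot D _).2 ⟨m, rfl⟩⟩, ?_⟩⟩,
      fun a ha => ⟨LinearEquiv.ofBijective
        ((LinearMap.proj (R := R) (φ := fun _ : List L => M) [⊥] ∘ₗ
          (minimalPiece D a).subtype).codRestrict (D.sub a ha) ?_) ⟨?_, ?_⟩, ?_⟩⟩
    · rintro ⟨v, hv⟩ ⟨v', hv'⟩ h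
      obtain ⟨m, rfl⟩ := (mem_minimalPiece_bot D v).1 hv
      obtain ⟨m', rfl⟩ := (mem_minimalPiece_bot D v').1 hv'
      have : m = m' := by simpa using h
      subst this
      rfl
    · simp
    · rintro ⟨v, hv⟩
      obtain ⟨m, hm, rfl⟩ := (mem_minimalPiece_atom D ha v).1 hv
      simpa using hm
    · rintro ⟨v, hv⟩ ⟨v', hv'⟩ h
      obtain ⟨m, hm, rfl⟩ := (mem_minimalPiece_atom D ha v).1 hv
      obtain ⟨m', hm', rfl⟩ := (mem_minimalPiece_atom D ha v').1 hv'
      have : m = m' := by simpa using congrArg Subtype.val h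
      subst this
      rfl
    · rintro ⟨m, hm⟩
      refine ⟨⟨Pi.single [⊥] m, (mem_minimalPiece_atom D ha _).2 ⟨m, hm, rfl⟩⟩, ?_⟩
      apply Subtype.ext
      simp
    · intro v
      rfl
  injective x hx hx' v hv := by
    have hv0 := ((mem_minimalPiece D hx hx' v.1).1 v.2).1
    apply Subtype.ext
    funext c
    cases c with
    | nil => exact hv0
    | cons y c => exact congrFun (congrArg Subtype.val (hv y)) c
  exact x hx hx' f hf hk := by
    let g : List L → M := fun c => match c with
      | [] => 0
      | y :: c => (f y).1 c
    have hg : ∀ y, shift R y g = (f y).1 := fun y => rfl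
    refine ⟨⟨g, (mem_minimalPiece D hx hx' g).2 ⟨rfl, fun y _ => (f y).2, fun y hy => ?_,
      fun z => ?_⟩⟩, fun y => rfl⟩
    · rw [hg, hf y hy]
      rfl
    · let φ : (minimalComplex D).piece z →ₗ[R] (List L → M) := (minimalPiece D z).subtype
      have h := congrArg φ (hk z)
      rw [map_sum, map_zero] at h
      exact h

end Minimal

end LGraded

/-- A finite (central) arrangement of hyperplanes in the vector space `W`. -/
structure HyperplaneArrangement (K : Type w) (W : Type v) [Field K] [AddCommGroup W]
    [Module K W] where
  hyperplanes : Set (Submodule K W)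
  finite : hyperplanes.Finite
  isCoatom : ∀ H ∈ hyperplanes, IsCoatom H

namespace HyperplaneArrangement

variable {K : Type w} {W : Type v} [Field K] [AddCommGroup W] [Module K W]

/-- The intersection lattice: all intersections of hyperplanes of the arrangement, including the
empty intersection `W`, ordered by reverse inclusion. -/
def IntersectionLattice (A : HyperplaneArrangement K W) : Type v :=
  {X : (Submodule K W)ᵒᵈ // ∃ B ⊆ A.hyperplanes, OrderDual.ofDual X = sInf B}

instance (A : HyperplaneArrangement K W) : PartialOrder A.IntersectionLattice :=
  inferInstanceAs (PartialOrder
    {X : (Submodule K W)ᵒᵈ // ∃ B ⊆ A.hyperplanes, OrderDual.ofDual X = sInf B})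

/-- The subspace of `W` given by an element of the intersection lattice. -/
def IntersectionLattice.space {A : HyperplaneArrangement K W} (X : A.IntersectionLattice) :
    Submodule K W :=
  OrderDual.ofDual X.1

theorem le_iff {A : HyperplaneArrangement K W} (X Y : A.IntersectionLattice) :
    X ≤ Y ↔ Y.space ≤ X.space := Iff.rfl

instance (A : HyperplaneArrangement K W) : OrderBot A.IntersectionLattice where
  bot := ⟨OrderDual.toDual ⊤, ∅, Set.empty_subset _, sInf_empty.symm⟩
  bot_le _ := (le_iff _ _).2 le_top

instance (A : HyperplaneArrangement K W) : Finite A.IntersectionLattice := by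
  have := A.finite.powerset.to_subtype
  refine Finite.of_surjective (α := 𝒫 A.hyperplanes)
    (fun B => ⟨OrderDual.toDual (sInf B.1), B.1, B.2, rfl⟩) ?_
  rintro ⟨X, B, hB, h⟩
  exact ⟨⟨B, hB⟩, Subtype.ext h.symm⟩

/-- The rank of the arrangement: the codimension of the intersection of all hyperplanes. -/
def rank (A : HyperplaneArrangement K W) : ℕ :=
  Module.finrank K (W ⧸ sInf A.hyperplanes)

/-- The defining atomic datum: the dual space `U` of `W` with the lines `H^⊥ ⊆ U`. The atoms of
the intersection lattice are the hyperplanes `H`. -/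
def definingDatum (A : HyperplaneArrangement K W) :
    LGraded.AtomicDatum K A.IntersectionLattice (Module.Dual K W) where
  sub a _ := a.space.dualAnnihilator

/-- The relation complex of the arrangement. -/
def relationComplex (A : HyperplaneArrangement K W) :
    LGraded.GradedComplex K A.IntersectionLattice :=
  LGraded.minimalComplex A.definingDatum

/-- The restriction of the arrangement to an element `X` of its intersection lattice: the
arrangement in the space `X` of the hyperplanes `H ∩ X`, where `H` does not contain `X`. -/
def restriction (A : HyperplaneArrangement K W) (X : A.IntersectionLattice) :
    HyperplaneArrangement K X.space where
  hyperplanes := {Y | ∃ H ∈ A.hyperplanes, ¬ X.space ≤ H ∧ Y = H.comap X.space.subtype}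
  finite := by
    refine (A.finite.image fun H => H.comap X.space.subtype).subset ?_
    rintro Y ⟨H, hH, -, rfl⟩
    exact ⟨H, hH, rfl⟩
  isCoatom := by
    rintro Y ⟨H, hH, hX, rfl⟩
    refine ⟨fun h => hX ?_, fun B hB => ?_⟩
    · rwa [Submodule.comap_subtype_eq_top] at h
    · obtain ⟨b, hb, hbH⟩ := SetLike.exists_of_lt hB
      have hbH' : (b : W) ∉ H := hbH
      have htop : H ⊔ Submodule.span K {(b : W)} = ⊤ := by
        refine (A.isCoatom H hH).2 _ (lt_of_le_of_ne le_sup_left fun h => hbH' ?_)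
        rw [h]
        exact Submodule.mem_sup_right (Submodule.mem_span_singleton_self _)
      rw [eq_top_iff]
      intro x _
      have hx : (x : W) ∈ H ⊔ Submodule.span K {(b : W)} := htop ▸ Submodule.mem_top
      obtain ⟨y, hy, z, hz, hyz⟩ := Submodule.mem_sup.1 hx
      obtain ⟨c, rfl⟩ := Submodule.mem_span_singleton.1 hz
      have hy' : x - c • b ∈ H.comap X.space.subtype := by
        have : ((x - c • b : X.space) : W) = y := by
          simp [← hyz]
        simpa [this] using hy
      have := B.add_mem (hB.le hy') (B.smul_mem c hb)
      simpa using this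

end HyperplaneArrangement

/-- A complex reflection: a linear automorphism of finite order whose space of fixed vectors is a
hyperplane. -/
def IsComplexReflection {V : Type v} [AddCommGroup V] [Module ℂ V] (g : V ≃ₗ[ℂ] V) : Prop :=
  IsOfFinOrder g ∧ IsCoatom (LinearMap.fixedSubmodule (g : V →ₗ[ℂ] V))

/-- The group `G` is generated by complex reflections. -/
def IsComplexReflectionGroup {V : Type v} [AddCommGroup V] [Module ℂ V]
    (G : Subgroup (V ≃ₗ[ℂ] V)) : Prop :=
  Subgroup.closure {g | g ∈ G ∧ IsComplexReflection g} = G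

/-- The arrangement of the reflecting hyperplanes of a finite group `G`. -/
def reflectionArrangement {V : Type v} [AddCommGroup V] [Module ℂ V]
    (G : Subgroup (V ≃ₗ[ℂ] V)) [Finite G] : HyperplaneArrangement ℂ V where
  hyperplanes := {H | ∃ g ∈ G, IsComplexReflection g ∧
    H = LinearMap.fixedSubmodule (g : V →ₗ[ℂ] V)}
  finite := by
    have hG : (G : Set (V ≃ₗ[ℂ] V)).Finite := Set.toFinite _
    refine (hG.image fun g : V ≃ₗ[ℂ] V => LinearMap.fixedSubmodule (g : V →ₗ[ℂ] V)).subset ?_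
    rintro H ⟨g, hg, -, rfl⟩
    exact ⟨g, hg, rfl⟩
  isCoatom := by
    rintro H ⟨g, -, hg, rfl⟩
    exact hg.2

end

noncomputable section

open scoped Classical

universe u v w

namespace LGraded

attribute [local instance] Fintype.ofFinite

/-! For `z` in the intersection lattice of the restriction, let T_z be the sum of `1 - g` over the
reflections `g` in `G` that fix `z` pointwise. Conjugation by one of these reflections permutes
them, so T_z commutes with each of them and therefore preserves every flat containing `z`, in
particular `X`. For a `G`-invariant form its kernel lies in `z` and its image is orthogonal to `z`.
Hence the transpose of T_x on the dual of `X` is injective on x^⊥, and its inverse J there preserves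
every a^⊥ with `a ≤ x`. Sorting the reflections by the atom in which their hyperplanes meet `X`
splits the transpose of T_z into operators with values in the lines a^⊥. Composed with J they give
δ_a with two properties: the sum over all atoms `a ≤ x` is the identity on these lines, and the sum
over the atoms below any `z ≤ x` is T_z^t J, which preserves a^⊥ for `a ≤ z`.

By `exists_lHomotopy` this datum in lowest degree suffices; the rest depends only on the order. Let
e = h∂ be known in rank n; one needs a new h with ∂h = 1 - e. An off-diagonal component of e from
`x` to `w` vanishes unless `x` and `w` cover a common element. Then exactly one `z` covers both, so
this component must be cancelled through V_z. An element of V_z is determined by its components away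
from `x`, so there is one candidate for h. It exists because the components of e below `z` can be
completed to a cycle by an element of V_x (`IsLiftable.lift`). The diagonal component is then
automatic. Acyclicity is the homotopy at the greatest element of the lattice. -/

theorem rk_bot {L : Type u} [PartialOrder L] [OrderBot L] : rk (⊥ : L) = 0 := by
  simp [rk]

/-! ### Rank functions on finite posets -/

section Rank

variable {L : Type u} [PartialOrder L] [Finite L]

theorem height_lt_top (x : L) : Order.height x < ⊤ := by
  by_contra h
  rw [not_lt_top_iff, Order.height_eq_top_iff] at h
  obtain ⟨p, -, hp⟩ := h (Fintype.card L)
  have := Fintype.card_le_of_injective p.toFun p.strictMono.injective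
  simp only [Fintype.card_fin] at this
  omega

theorem coe_rk (x : L) : ((rk x : ℕ) : ℕ∞) = Order.height x :=
  ENat.natCast_toNat (height_lt_top x).ne

theorem rk_strictMono : StrictMono (rk : L → ℕ) := fun x y h => by
  have := Order.height_strictMono h (height_lt_top x)
  rwa [← coe_rk, ← coe_rk, Nat.cast_lt] at this

theorem rk_eq_zero [OrderBot L] {x : L} : rk x = 0 ↔ x = ⊥ := by
  refine ⟨fun h => ?_, fun h => h ▸ rk_bot⟩
  by_contra hx
  have := rk_strictMono (bot_lt_iff_ne_bot.2 hx)
  omega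

theorem covBy_of_rk {x y : L} (h : y ≤ x) (hr : rk x = rk y + 1) : y ⋖ x := by
  have hlt : y < x := lt_of_le_of_ne h (by rintro rfl; omega)
  refine ⟨hlt, fun c h₁ h₂ => ?_⟩
  have := rk_strictMono h₁
  have := rk_strictMono h₂
  omega

/-- A function that increases by one along covers and vanishes at `⊥` is the rank function. -/
theorem rk_eq_of_covBy [OrderBot L] (f : L → ℕ) (hf : f ⊥ = 0)
    (h : ∀ y x : L, y ⋖ x → f x = f y + 1) (x : L) : rk x = f x := by
  have hmono : StrictMono f := by
    -- Induction on a bound for the rank gap, passing from `y` to a cover of `y` that is still `≤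
    -- x`.
    have key : ∀ n : ℕ, ∀ y x : L, rk x ≤ rk y + n → y < x → f y < f x := by
      intro n
      induction n with
      | zero =>
        intro y x hr hlt
        have := rk_strictMono hlt
        omega
      | succ n ih =>
        intro y x hr hlt
        obtain ⟨c, hc, hcx⟩ := exists_covBy_le_of_lt hlt
        have h1 := h y c hc
        rcases hcx.eq_or_lt with rfl | hcx
        · omega
        · have := ih c x (by have := rk_strictMono hc.lt; omega) hcx
          omega
    exact fun y x hlt => key (rk x) y x (by omega) hlt
  induction x using (wellFounded_lt (α := L)).induction with
  | _ x ih =>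
    by_cases hx : x = ⊥
    · rw [hx, rk_bot, hf]
    · apply le_antisymm
      · have hle : Order.height x ≤ (f x : ℕ) := Order.height_le_coe_iff.2 fun y hy => by
          rw [← coe_rk, ih y hy]
          exact_mod_cast hmono hy
        rw [← coe_rk] at hle
        exact_mod_cast hle
      · obtain ⟨y, -, hy⟩ := exists_le_covBy_of_lt (bot_lt_iff_ne_bot.2 hx)
        rw [h y x hy, ← ih y hy.lt]
        exact rk_strictMono hy.lt

end Rank

/-- The properties of the covering relation of a geometric lattice that are used below. -/
structure IsSemimodular (L : Type u) [PartialOrder L] : Prop where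
  rk_covBy : ∀ y x : L, y ⋖ x → rk x = rk y + 1
  exists_join : ∀ y w x : L, y ⋖ w → y ⋖ x → w ≠ x →
    ∃ z, w ⋖ z ∧ x ⋖ z ∧ ∀ t, w ≤ t → x ≤ t → z ≤ t
  eq_or_le : ∀ x z z' u : L, x ⋖ z → x ⋖ z' → u ≤ z → u ≤ z' → z = z' ∨ u ≤ x

/-- Otherwise `w` would lie strictly below `x`, although both have rank one less than `z`. Thus the
cancellations through different covers of `x` do not interfere. -/
theorem IsSemimodular.eq_of_covBy {L : Type u} [PartialOrder L] [Finite L]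
    (hL : IsSemimodular L) {x w z z' : L} (hne : w ≠ x) (hx : x ⋖ z) (hx' : x ⋖ z')
    (hw : w ⋖ z) (hw' : w ⋖ z') : z = z' := by
  refine (hL.eq_or_le x z z' w hx hx' hw.le hw'.le).resolve_right fun h => ?_
  have h1 := rk_strictMono (lt_of_le_of_ne h hne)
  have h2 := hL.rk_covBy _ _ hx
  have h3 := hL.rk_covBy _ _ hw
  omega

/-! ### Extending a homotopy degree by degree -/

namespace GradedComplex

variable {R : Type w} [Ring R] {L : Type u} [PartialOrder L] [Finite L]

theorem bd_bd_apply (V : GradedComplex.{u, v, w} R L) (x z : L) (v : V.piece x) :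
    ∑ y : L, V.bd y z (V.bd x y v) = 0 := by
  simpa [LinearMap.sum_apply] using LinearMap.congr_fun (V.bd_comp x z) v

/-- Matrices of linear maps between the graded pieces. -/
abbrev Mat (V : GradedComplex.{u, v, w} R L) := ∀ x y : L, V.piece x →ₗ[R] V.piece y

/-- The pieces of `V` of rank at least two are the kernels of the boundary map, and the boundary
map is injective on the atoms. -/
structure HasKernelPieces [OrderBot L] (V : GradedComplex.{u, v, w} R L) : Prop where
  injective : ∀ x : L, x ≠ ⊥ → ∀ v : V.piece x, (∀ y, V.bd x y v = 0) → v = 0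
  exact : ∀ x : L, x ≠ ⊥ → ¬ IsAtom x → ∀ f : (∀ y, V.piece y), (∀ y, ¬ y ⋖ x → f y = 0) →
    (∀ z, ∑ y : L, V.bd y z (f y) = 0) → ∃ v : V.piece x, ∀ y, V.bd x y v = f y

/-- The properties of the composite `e = h_{n-1} ∂_n` that allow to extend the homotopy. -/
structure IsLiftable (V : GradedComplex.{u, v, w} R L) (n : ℕ) (e : V.Mat) : Prop where
  supp : ∀ x w : L, rk x = n → w ≠ x → (∀ y, y ⋖ x → ¬ y ⋖ w) → e x w = 0
  bd : ∀ x : L, rk x = n → ∀ u v, ∑ w, V.bd w u (e x w v) = V.bd x u v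
  nil : ∀ x : L, rk x = n + 1 → ∀ u v, ∑ y, e y u (V.bd x y v) = 0
  lift : ∀ x z : L, rk x = n → x ⋖ z → ∀ v, ∃ t : V.piece z,
    ∀ w, w ≠ x → w ⋖ z → V.bd z w t = - e x w v

/-- `h` is a graded homotopy between `e` and the identity on the pieces of rank `n`. -/
structure IsStep (V : GradedComplex.{u, v, w} R L) (n : ℕ) (e h : V.Mat) : Prop where
  graded : ∀ x z : L, ¬ x ⋖ z → h x z = 0
  homotopy : ∀ x : L, rk x = n → ∀ w v,
    e x w v + ∑ z, V.bd z w (h x z v) = (Pi.single x v : ∀ y, V.piece y) w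

variable {V : GradedComplex.{u, v, w} R L}

/-- The map between chain modules given by a matrix. -/
def Mat.toChain (m : V.Mat) (i j : ℕ) : V.chain i →ₗ[R] V.chain j :=
  LinearMap.pi fun y => ∑ x : {x : L // rk x = i},
    m x.1 y.1 ∘ₗ LinearMap.proj (R := R) (φ := fun x : {x : L // rk x = i} => V.piece x.1) x

theorem Mat.toChain_apply (m : V.Mat) (i j : ℕ) (f : V.chain i) (y : {y : L // rk y = j}) :
    m.toChain i j f y = ∑ x : {x : L // rk x = i}, m x.1 y.1 (f x) := by
  simp [Mat.toChain, LinearMap.sum_apply]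

theorem Mat.toChain_single (m : V.Mat) (i j : ℕ) (x : {x : L // rk x = i}) (v : V.piece x.1)
    (y : {y : L // rk y = j}) : m.toChain i j (Pi.single x v) y = m x.1 y.1 v := by
  rw [Mat.toChain_apply, Finset.sum_eq_single x, Pi.single_eq_same]
  · intro x' _ hx'
    rw [Pi.single_eq_of_ne hx', map_zero]
  · simp

theorem d_eq_toChain (i : ℕ) : V.d i = Mat.toChain (V := V) V.bd (i + 1) i := rfl

theorem sum_rk {M : Type*} [AddCommMonoid M] (j : ℕ) (f : L → M) (hf : ∀ y, rk y ≠ j → f y = 0) :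
    ∑ y : {y : L // rk y = j}, f y.1 = ∑ y, f y := by
  refine Fintype.sum_of_injective Subtype.val Subtype.val_injective _ _ (fun y hy => hf y ?_)
    fun _ => rfl
  exact fun h => hy ⟨⟨y, h⟩, rfl⟩

theorem Mat.toChain_toChain_single (m m' : V.Mat) (i j k : ℕ) (x : {x : L // rk x = i})
    (hm : ∀ y, rk y ≠ j → m x.1 y = 0)
    (v : V.piece x.1) (z : {z : L // rk z = k}) :
    m'.toChain j k (m.toChain i j (Pi.single x v)) z = ∑ y, m' y z.1 (m x.1 y v) := by
  rw [Mat.toChain_apply, ← sum_rk j fun y => m' y z.1 (m x.1 y v)]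
  · exact Finset.sum_congr rfl fun y _ => by rw [Mat.toChain_single]
  · intro y hy
    rw [hm y hy, LinearMap.zero_apply, map_zero]

theorem chain_hom_ext {i j : ℕ} {f g : V.chain i →ₗ[R] V.chain j}
    (h : ∀ x v y, f (Pi.single x v) y = g (Pi.single x v) y) : f = g :=
  LinearMap.pi_ext fun x v => funext fun y => h x v y

theorem single_coe {i : ℕ} (x : {x : L // rk x = i}) (v : V.piece x.1) (y : {x : L // rk x = i}) :
    (Pi.single x v : V.chain i) y = (Pi.single x.1 v : ∀ y, V.piece y) y.1 := by
  by_cases h : y = x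
  · subst h
    simp
  · rw [Pi.single_eq_of_ne h, Pi.single_eq_of_ne fun h' => h (Subtype.ext h')]

variable [OrderBot L]

/-- Only the `x`-component of ∂t can survive; ∂∂t = 0 makes it a cycle, and ∂ is injective on V_x.
-/
theorem HasKernelPieces.eq_zero_of_covBy (hV : V.HasKernelPieces) {x z : L} (hx : x ≠ ⊥)
    (hz : x ⋖ z) (t : V.piece z) (ht : ∀ w, w ≠ x → V.bd z w t = 0) : t = 0 := by
  refine hV.injective z hz.lt.ne_bot t fun w => ?_
  by_cases hw : w = x
  · subst hw
    refine hV.injective w hx _ fun u => ?_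
    have h := V.bd_bd_apply z u t
    rwa [Finset.sum_eq_single w (fun y _ hy => by rw [ht y hy, map_zero]) (by simp)] at h
  · exact ht w hw

/-- The lifts given pointwise by `IsLiftable.lift` are unique, so they form a linear map: the
inverse of an injective map on its range, applied to the components of `-e`. -/
theorem IsLiftable.exists_linear (hV : V.HasKernelPieces) {n : ℕ} (hn : n ≠ 0) {e : V.Mat}
    (he : V.IsLiftable n e) (x z : L) (hx : rk x = n) (hz : x ⋖ z) :
    ∃ h : V.piece x →ₗ[R] V.piece z, ∀ v w, w ≠ x → w ⋖ z → V.bd z w (h v) = - e x w v := by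
  have hx0 : x ≠ ⊥ := fun h => hn (by rw [← hx, h, rk_bot])
  let f : V.piece z →ₗ[R] (∀ w : {w : L // w ≠ x ∧ w ⋖ z}, V.piece w.1) :=
    LinearMap.pi fun w => V.bd z w.1
  let g : V.piece x →ₗ[R] (∀ w : {w : L // w ≠ x ∧ w ⋖ z}, V.piece w.1) :=
    LinearMap.pi fun w => - e x w.1
  have hf : Function.Injective f := by
    rw [← LinearMap.ker_eq_bot, LinearMap.ker_eq_bot']
    intro t ht
    refine hV.eq_zero_of_covBy hx0 hz t fun w hw => ?_
    by_cases hwz : w ⋖ z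
    · exact congrFun ht ⟨w, hw, hwz⟩
    · rw [V.bd_eq_zero z w hwz, LinearMap.zero_apply]
  have hg : ∀ v, g v ∈ LinearMap.range f := fun v => by
    obtain ⟨t, ht⟩ := he.lift x z hx hz v
    exact ⟨t, funext fun w => ht w.1 w.2.1 w.2.2⟩
  refine ⟨(LinearEquiv.ofInjective f hf).symm.toLinearMap ∘ₗ g.codRestrict _ hg,
    fun v w hw hwz => ?_⟩
  have := (LinearEquiv.ofInjective f hf).apply_symm_apply (g.codRestrict _ hg v)
  exact congrFun (congrArg Subtype.val this) ⟨w, hw, hwz⟩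

theorem IsLiftable.exists_isStep (hL : IsSemimodular L) (hV : V.HasKernelPieces) {n : ℕ}
    (hn : n ≠ 0) {e : V.Mat} (he : V.IsLiftable n e) : ∃ h : V.Mat, V.IsStep n e h := by
  have key : ∀ x z : L, ∃ h : V.piece x →ₗ[R] V.piece z, (¬ x ⋖ z → h = 0) ∧
      (rk x = n → x ⋖ z → ∀ v w, w ≠ x → w ⋖ z → V.bd z w (h v) = - e x w v) := by
    intro x z
    by_cases h : rk x = n ∧ x ⋖ z
    · obtain ⟨f, hf⟩ := he.exists_linear hV hn x z h.1 h.2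
      exact ⟨f, fun h' => absurd h.2 h', fun _ _ => hf⟩
    · exact ⟨0, fun _ => rfl, fun h1 h2 => absurd ⟨h1, h2⟩ h⟩
  choose h hgr hh using key
  refine ⟨h, hgr, fun x hx w v => ?_⟩
  -- Off the diagonal, the only possible contribution to the sum is the unique common cover of `w`
  -- and `x`; if there is none, both terms vanish.
  have hoff : ∀ w, w ≠ x → e x w v + ∑ z, V.bd z w (h x z v) = 0 := by
    intro w hw
    by_cases hz : ∃ z, w ⋖ z ∧ x ⋖ z
    · obtain ⟨z, hwz, hxz⟩ := hz
      rw [Finset.sum_eq_single z, hh x z hx hxz v w hw hwz, add_neg_cancel]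
      · intro z' _ hz'
        by_cases hxz' : x ⋖ z'
        · rw [V.bd_eq_zero z' w fun hwz' =>
            hz' (hL.eq_of_covBy hw hxz' hxz hwz' hwz), LinearMap.zero_apply]
        · rw [hgr x z' hxz', LinearMap.zero_apply, map_zero]
      · simp
    · have h0 : e x w = 0 := he.supp x w hx hw fun y hy hyw => by
        obtain ⟨z, h1, h2, -⟩ := hL.exists_join y w x hyw hy hw
        exact hz ⟨z, h1, h2⟩
      rw [h0, LinearMap.zero_apply, zero_add]
      refine Finset.sum_eq_zero fun z _ => ?_
      by_cases hxz : x ⋖ z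
      · rw [V.bd_eq_zero z w fun hwz => hz ⟨z, hwz, hxz⟩, LinearMap.zero_apply]
      · rw [hgr x z hxz, LinearMap.zero_apply, map_zero]
  by_cases hw : w = x
  · subst hw
    rw [Pi.single_eq_same]
    have hx0 : w ≠ ⊥ := fun h => hn (by rw [← hx, h, rk_bot])
    -- The diagonal component follows from the others: e + ∂h and the identity have the same
    -- boundary, and ∂ is injective on the piece.
    rw [← sub_eq_zero]
    refine hV.injective w hx0 _ fun u => ?_
    have h1 : ∑ y, V.bd y u (e w y v + ∑ z, V.bd z y (h w z v)) = V.bd w u v := by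
      simp only [map_add, Finset.sum_add_distrib, map_sum]
      rw [he.bd w hx u v, Finset.sum_comm]
      simp [V.bd_bd_apply]
    rw [Finset.sum_eq_single w (fun y _ hy => by rw [hoff y hy, map_zero]) (by simp)] at h1
    rw [map_sub, h1, sub_self]
  · rw [hoff w hw, Pi.single_eq_of_ne hw]

/-- The support, boundary and nilpotency conditions follow from grading, the homotopy identity and
∂∂ = 0. The real content is the lift: the part of the new e lying below `z` and away from `x` has
boundary supported on the lower covers of `x`, so an element of V_x corrects it to a cycle, that is,
to an element of V_z. -/
theorem IsStep.isLiftable (hL : IsSemimodular L) (hV : V.HasKernelPieces) {n : ℕ}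
    (hn : n ≠ 0) {e h : V.Mat} (he : V.IsLiftable n e) (hh : V.IsStep n e h) :
    V.IsLiftable (n + 1) (fun x w => ∑ y, h y w ∘ₗ V.bd x y) := by
  have hsupp : ∀ x w : L, (∀ y, y ⋖ x → ¬ y ⋖ w) → ∑ y, h y w ∘ₗ V.bd x y = 0 := by
    intro x w hw
    refine Finset.sum_eq_zero fun y _ => ?_
    by_cases hy : y ⋖ x
    · rw [hh.graded y w (hw y hy), LinearMap.zero_comp]
    · rw [V.bd_eq_zero x y hy, LinearMap.comp_zero]
  have hbd : ∀ x : L, rk x = n + 1 → ∀ u v,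
      ∑ w, V.bd w u ((∑ y, h y w ∘ₗ V.bd x y) v) = V.bd x u v := by
    intro x hx u v
    have h1 : ∀ y, ∑ w, V.bd w u (h y w (V.bd x y v)) =
        (Pi.single y (V.bd x y v) : ∀ y, V.piece y) u - e y u (V.bd x y v) := by
      intro y
      by_cases hy : y ⋖ x
      · rw [eq_sub_iff_add_eq, add_comm]
        exact hh.homotopy y (by have := hL.rk_covBy y x hy; omega) u _
      · simp [V.bd_eq_zero x y hy]
    simp only [LinearMap.sum_apply, LinearMap.comp_apply, map_sum]
    rw [Finset.sum_comm, Finset.sum_congr rfl fun y _ => h1 y, Finset.sum_sub_distrib,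
      he.nil x hx u v, sub_zero]
    simp
  refine ⟨fun x w _ _ => hsupp x w, hbd, fun x hx u v => ?_, fun x z hx hz v => ?_⟩
  · simp only [LinearMap.sum_apply, LinearMap.comp_apply]
    rw [Finset.sum_comm]
    simp only [← map_sum, V.bd_bd_apply, map_zero, Finset.sum_const_zero]
  · generalize hE : (fun w => ∑ y, h y w ∘ₗ V.bd x y) = E at hsupp hbd
    have hE' : ∀ w, ∑ y, h y w ∘ₗ V.bd x y = E w := fun w => congrFun hE w
    have hb : ∀ u v, ∑ w, V.bd w u (E w v) = V.bd x u v := fun u v => by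
      simpa only [hE'] using hbd x hx u v
    have hs : ∀ w, (∀ y, y ⋖ x → ¬ y ⋖ w) → E w = 0 := fun w hw => by
      rw [← hE']
      exact hsupp x w hw
    simp only [hE']
    clear hsupp hbd
    have hx0 : x ≠ ⊥ := fun h => by rw [h, rk_bot] at hx; omega
    have hxa : ¬ IsAtom x := fun h => by
      have := hL.rk_covBy _ _ (bot_covBy_iff.2 h)
      rw [rk_bot] at this
      omega
    have hza : ¬ IsAtom z := fun h => hx0 (h.2 x hz.lt)
    let f : ∀ w, V.piece w := fun w => if w ≠ x ∧ w ⋖ z then E w v else 0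
    -- The full sum over `w` gives the `u`-component of ∂v, which is zero. A dropped term that
    -- reaches `u ≤ z` would have `w` and `x` joined in some `z' ≠ z`; then `u` lies below both
    -- covers, hence below `x`, and by rank is covered by `x`.
    have hfd : ∀ u, ¬ u ⋖ x → ∑ w, V.bd w u (f w) = 0 := by
      intro u hu
      by_cases huz : u ≤ z
      · have : ∑ w, V.bd w u (f w) = ∑ w, V.bd w u (E w v) := by
          refine Finset.sum_congr rfl fun w _ => ?_
          by_cases hw : w ≠ x ∧ w ⋖ z
          · simp only [f, if_pos hw]
          · simp only [f, if_neg hw, map_zero]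
            by_cases hwx : w = x
            · subst hwx
              rw [V.bd_eq_zero w u hu, LinearMap.zero_apply]
            · by_cases huw : u ⋖ w
              · rw [hs w, LinearMap.zero_apply, map_zero]
                intro y hy hyw
                obtain ⟨z', hwz', hxz', -⟩ := hL.exists_join y w x hyw hy hwx
                rcases hL.eq_or_le x z z' u hz hxz' huz (huw.le.trans hwz'.le) with rfl | h'
                · exact hw ⟨hwx, hwz'⟩
                · refine hu (covBy_of_rk h' ?_)
                  have h1 := hL.rk_covBy _ _ huw
                  have h2 := hL.rk_covBy _ _ hyw
                  have h3 := hL.rk_covBy _ _ hy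
                  omega
              · rw [V.bd_eq_zero w u huw, LinearMap.zero_apply]
        rw [this, hb, V.bd_eq_zero x u hu, LinearMap.zero_apply]
      · refine Finset.sum_eq_zero fun w _ => ?_
        by_cases hw : w ≠ x ∧ w ⋖ z
        · rw [V.bd_eq_zero w u fun h' => huz (h'.le.trans hw.2.le), LinearMap.zero_apply]
        · simp only [f, if_neg hw, map_zero]
    -- The boundary of `f` is a cycle supported on the lower covers of `x`, hence equals ∂c with `c`
    -- in V_x.
    obtain ⟨c, hc⟩ := hV.exact x hx0 hxa (fun u => ∑ w, V.bd w u (f w)) hfd fun s => by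
      simp only [map_sum]
      rw [Finset.sum_comm]
      simp [V.bd_bd_apply]
    obtain ⟨t, ht⟩ := hV.exact z hz.lt.ne_bot hza
      (fun w => (Pi.single x c : ∀ y, V.piece y) w - f w) (fun y hy => by
        have hyx : y ≠ x := fun h => hy (h ▸ hz)
        simp [f, hy, hyx]) fun u => by
      simp only [map_sub, Finset.sum_sub_distrib]
      rw [Finset.sum_eq_single x (fun y _ hy => by rw [Pi.single_eq_of_ne hy, map_zero]) (by simp),
        Pi.single_eq_same, hc, sub_self]
    refine ⟨t, fun w hw hwz => ?_⟩
    rw [ht, Pi.single_eq_of_ne hw]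
    simp [f, hw, hwz]

/-- A homotopy in the lowest degree extends to an `L`-homotopy. -/
theorem exists_lHomotopy (hL : IsSemimodular L) (hV : V.HasKernelPieces)
    (k : ∀ w : L, V.piece ⊥ →ₗ[R] V.piece w) (hk : ∀ w, ¬ IsAtom w → k w = 0)
    (hid : ∀ a, IsAtom a → ∀ v, ∑ w, V.bd w ⊥ (k w (V.bd a ⊥ v)) = V.bd a ⊥ v)
    (hloc : ∀ a z, IsAtom a → a ⋖ z → ∀ v, ∃ c : V.piece a,
      ∑ w : L, (if w ⋖ z then V.bd w ⊥ (k w (V.bd a ⊥ v)) else 0) = V.bd a ⊥ c) :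
    Nonempty (LHomotopy V) := by
  have hatom : ∀ a : L, rk a = 1 ↔ IsAtom a := fun a => by
    constructor
    · intro h
      rw [← bot_covBy_iff]
      exact covBy_of_rk bot_le (by rw [rk_bot, h])
    · intro h
      rw [hL.rk_covBy _ _ (bot_covBy_iff.2 h), rk_bot]
  have hbd0 : ∀ w u, IsAtom w → u ≠ ⊥ → V.bd w u = 0 := fun w u hw hu =>
    V.bd_eq_zero w u fun h => hu (hw.2 u h.lt)
  let e₁ : V.Mat := fun a w => k w ∘ₗ V.bd a ⊥
  have h₁ : V.IsLiftable 1 e₁ := by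
    refine ⟨fun x w hx _ h => ?_, fun x hx u v => ?_, fun x hx u v => ?_, fun x z hx hz v => ?_⟩
    · have : ¬ IsAtom w := fun hw => h ⊥ (bot_covBy_iff.2 ((hatom x).1 hx)) (bot_covBy_iff.2 hw)
      simp [e₁, hk w this]
    · by_cases hu : u = ⊥
      · subst hu
        exact hid x ((hatom x).1 hx) v
      · rw [hbd0 x u ((hatom x).1 hx) hu, LinearMap.zero_apply]
        refine Finset.sum_eq_zero fun w _ => ?_
        by_cases hw : IsAtom w
        · rw [hbd0 w u hw hu, LinearMap.zero_apply]
        · simp [e₁, hk w hw]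
    · simp only [e₁, LinearMap.comp_apply]
      rw [← map_sum, V.bd_bd_apply, map_zero]
    · have hxa := (hatom x).1 hx
      obtain ⟨c, hc⟩ := hloc x z hxa hz v
      have hza : ¬ IsAtom z := fun h => hxa.1 (h.2 x hz.lt)
      -- The locality hypothesis supplies the correction `c` in the atom itself, making this family
      -- a cycle on the lower covers of `z`.
      obtain ⟨t, ht⟩ := hV.exact z hz.lt.ne_bot hza (fun w =>
        (Pi.single x c : ∀ y, V.piece y) w - if w ⋖ z then e₁ x w v else 0) (fun y hy => by
          have hyx : y ≠ x := fun h => hy (h ▸ hz)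
          simp [hy, hyx]) fun u => by
        simp only [map_sub, Finset.sum_sub_distrib]
        rw [Finset.sum_eq_single x
          (fun y _ hy => by rw [Pi.single_eq_of_ne hy, map_zero]) (by simp), Pi.single_eq_same]
        by_cases hu : u = ⊥
        · subst hu
          rw [← hc, sub_eq_zero]
          refine Finset.sum_congr rfl fun w _ => ?_
          split_ifs <;> simp [e₁]
        · rw [hbd0 x u hxa hu, LinearMap.zero_apply, zero_sub, neg_eq_zero]
          refine Finset.sum_eq_zero fun w _ => ?_
          by_cases hw : IsAtom w
          · rw [hbd0 w u hw hu, LinearMap.zero_apply]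
          · simp [e₁, hk w hw]
      refine ⟨t, fun w hw hwz => ?_⟩
      rw [ht, Pi.single_eq_of_ne hw, if_pos hwz, zero_sub]
  -- The recursion carries e and h with their properties, since the next e is built from the current
  -- h. Index `n` corresponds to rank `n + 1`.
  let S : ℕ → Type _ := fun n => {p : V.Mat × V.Mat // V.IsLiftable (n + 1) p.1 ∧
    V.IsStep (n + 1) p.1 p.2}
  let next : ∀ n, S n → S (n + 1) := fun n p =>
    have hlift := p.2.2.isLiftable hL hV n.succ_ne_zero p.2.1
    ⟨⟨_, (hlift.exists_isStep hL hV (Nat.succ_ne_zero _)).choose⟩, hlift,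
      (hlift.exists_isStep hL hV (Nat.succ_ne_zero _)).choose_spec⟩
  let s₀ : S 0 := ⟨⟨e₁, (h₁.exists_isStep hL hV one_ne_zero).choose⟩, h₁,
    (h₁.exists_isStep hL hV one_ne_zero).choose_spec⟩
  let s : ∀ n, S n := fun n => Nat.rec s₀ next n
  have hs0 : (s 0).1.1 = e₁ := rfl
  have hs : ∀ n, (s (n + 1)).1.1 = fun x w => ∑ y, (s n).1.2 y w ∘ₗ V.bd x y := fun n => rfl
  have hbdrk : ∀ (i : ℕ) (x : L), rk x = i + 1 → ∀ y, rk y ≠ i → V.bd x y = 0 :=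
    fun i x hx y hy => V.bd_eq_zero x y fun h => hy (by have := hL.rk_covBy _ _ h; omega)
  have hhrk : ∀ n (i : ℕ) (x : L), rk x = i → ∀ y, rk y ≠ i + 1 → (s n).1.2 x y = 0 :=
    fun n i x hx y hy => (s n).2.2.graded x y fun h => hy (by
      have := hL.rk_covBy _ _ h; omega)
  -- `k` as a matrix whose only nonzero row is at `⊥`, the sole element of rank zero.
  let k' : V.Mat := fun x w => if hx : x = ⊥ then hx ▸ k w else 0
  have hk' : ∀ w, k' ⊥ w = k w := fun w => by simp [k']
  refine ⟨⟨Mat.toChain k' 0 1 ∘ₗ (LinearMap.range (V.d 0)).subtype,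
    fun i => Mat.toChain (s i).1.2 (i + 1) (i + 2), ?_, fun i => ?_, fun i x y v hxy => ?_⟩⟩
  · refine chain_hom_ext fun x v y => ?_
    have hk1 : (Mat.toChain k' 0 1 (V.d 0 (Pi.single x v))) y = e₁ x.1 y.1 v := by
      rw [d_eq_toChain, Mat.toChain_toChain_single _ _ _ _ _ _ (hbdrk 0 x.1 x.2),
        Finset.sum_eq_single ⊥, hk']
      · rfl
      · intro u _ hu
        rw [hbdrk 0 x.1 x.2 u (fun h => hu (rk_eq_zero.1 h)), LinearMap.zero_apply, map_zero]
      · simp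
    have h2 : (V.d 1 (Mat.toChain (s 0).1.2 1 2 (Pi.single x v))) y =
        ∑ z, V.bd z y.1 ((s 0).1.2 x.1 z v) := by
      rw [d_eq_toChain, Mat.toChain_toChain_single _ _ _ _ _ _ (hhrk 0 1 x.1 x.2)]
    change (Mat.toChain k' 0 1 (V.d 0 (Pi.single x v))) y +
      (V.d 1 (Mat.toChain (s 0).1.2 1 2 (Pi.single x v))) y = (Pi.single x v : V.chain 1) y
    rw [hk1, h2, single_coe]
    exact (s 0).2.2.homotopy x.1 x.2 y.1 v
  · refine chain_hom_ext fun x v y => ?_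
    change (Mat.toChain (s i).1.2 (i + 1) (i + 2) (V.d (i + 1) (Pi.single x v))) y +
      (V.d (i + 2) (Mat.toChain (s (i + 1)).1.2 (i + 2) (i + 3) (Pi.single x v))) y =
        (Pi.single x v : V.chain (i + 2)) y
    rw [d_eq_toChain, Mat.toChain_toChain_single _ _ _ _ _ _ (hbdrk (i + 1) x.1 x.2),
      d_eq_toChain, Mat.toChain_toChain_single _ _ _ _ _ _ (hhrk (i + 1) (i + 2) x.1 x.2),
      single_coe, ← (s (i + 1)).2.2.homotopy x.1 x.2 y.1 v, hs]
    simp only [LinearMap.sum_apply, LinearMap.comp_apply]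
  · rw [Mat.toChain_single, (s i).2.2.graded x.1 y.1 hxy, LinearMap.zero_apply]

end GradedComplex

end LGraded
namespace LGraded

attribute [local instance] Fintype.ofFinite

/-! ### Passage to lower intervals -/

section Iic

variable {L : Type u} [PartialOrder L]

theorem covBy_coe_iff {x : L} {y z : Set.Iic x} : y.1 ⋖ z.1 ↔ y ⋖ z :=
  ⟨fun h => ⟨h.lt, fun c hc hc' => h.2 (c := c.1) hc hc'⟩,
    fun h => ⟨h.lt, fun c hc hc' => h.2 (c := ⟨c, hc'.le.trans z.2⟩) hc hc'⟩⟩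

theorem isAtom_coe_iff [OrderBot L] {x : L} {a : Set.Iic x} : IsAtom a.1 ↔ IsAtom a := by
  rw [← bot_covBy_iff, ← bot_covBy_iff, ← covBy_coe_iff]
  rfl

variable [Finite L]

theorem sum_Iic {N : Type*} [AddCommMonoid N] (x : L) [Fintype (Set.Iic x)] (f : L → N) (hf : ∀ y, ¬ y ≤ x → f y = 0) :
    ∑ y : Set.Iic x, f y.1 = ∑ y, f y :=
  Fintype.sum_of_injective Subtype.val Subtype.val_injective _ _
    (fun y hy => hf y fun h => hy ⟨⟨y, h⟩, rfl⟩) fun _ => rfl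

variable [OrderBot L]

theorem IsSemimodular.rk_coe (hL : IsSemimodular L) (x : L) (y : Set.Iic x) : rk y = rk y.1 :=
  rk_eq_of_covBy (fun y : Set.Iic x => rk y.1) rk_bot
    (fun _ _ h => hL.rk_covBy _ _ (covBy_coe_iff.2 h)) y

theorem IsSemimodular.Iic (hL : IsSemimodular L) (x : L) : IsSemimodular (Set.Iic x) where
  rk_covBy y z h := by
    rw [hL.rk_coe, hL.rk_coe]
    exact hL.rk_covBy _ _ (covBy_coe_iff.2 h)
  exists_join y w t hw ht hne := by
    obtain ⟨z, h1, h2, h3⟩ := hL.exists_join y.1 w.1 t.1 (covBy_coe_iff.2 hw) (covBy_coe_iff.2 ht)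
      (fun h => hne (Subtype.ext h))
    exact ⟨⟨z, h3 x w.2 t.2⟩, covBy_coe_iff.1 h1, covBy_coe_iff.1 h2, fun s hs hs' => h3 s.1 hs hs'⟩
  eq_or_le y z z' t h h' ht ht' :=
    (hL.eq_or_le y.1 z.1 z'.1 t.1 (covBy_coe_iff.2 h) (covBy_coe_iff.2 h') ht ht').imp
      (fun h => Subtype.ext h) id

end Iic

namespace GradedComplex

section

variable {R : Type w} [Ring R] {L : Type u} [PartialOrder L] [Finite L]
  {V : GradedComplex.{u, v, w} R L}

theorem d_comp_d (hL : IsSemimodular L) (i : ℕ) : V.d i ∘ₗ V.d (i + 1) = 0 := by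
  refine chain_hom_ext fun x v y => ?_
  have h := Mat.toChain_toChain_single (V := V) V.bd V.bd (i + 2) (i + 1) i x
    (fun z hz => V.bd_eq_zero x.1 z fun h => hz (by
      have := hL.rk_covBy _ _ h
      have := x.2
      omega)) v y
  rw [V.bd_bd_apply] at h
  exact h

/-- On a cycle the homotopy identity reduces to v = ∂hv. -/
theorem LHomotopy.ker_le_range (h : LHomotopy V) (i : ℕ) :
    LinearMap.ker (V.d i) ≤ LinearMap.range (V.d (i + 1)) := by
  intro v hv
  rw [LinearMap.mem_ker] at hv
  cases i with
  | zero =>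
    refine ⟨h.h 0 v, ?_⟩
    have h1 := LinearMap.congr_fun h.homotopy_one v
    have h2 : (V.d 0).rangeRestrict v = 0 := Subtype.ext hv
    simpa [h2] using h1
  | succ i =>
    refine ⟨h.h (i + 1) v, ?_⟩
    have h1 := LinearMap.congr_fun (h.homotopy_succ i) v
    simpa [hv] using h1

variable [OrderBot L]

theorem HasKernelPieces.below (hV : V.HasKernelPieces) (x : L) : (V.below x).HasKernelPieces where
  injective y hy v hv := by
    refine hV.injective y.1 (fun h => hy (Subtype.ext h)) v fun z => ?_
    by_cases hz : z ⋖ y.1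
    · exact hv ⟨z, hz.le.trans y.2⟩
    · exact LinearMap.congr_fun (V.bd_eq_zero y.1 z hz) v
  exact y hy hy' f hf hk := by
    let g : ∀ z, V.piece z := fun z => if hz : z ≤ x then f ⟨z, hz⟩ else 0
    have hg : ∀ z : Set.Iic x, g z.1 = f z := fun z => dif_pos z.2
    obtain ⟨v, hv⟩ := hV.exact y.1 (fun h => hy (Subtype.ext h))
      (fun h => hy' (isAtom_coe_iff.1 h)) g (fun z hz => by
        by_cases hzx : z ≤ x
        · rw [hg ⟨z, hzx⟩]
          exact hf _ fun h => hz (covBy_coe_iff.2 h)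
        · exact dif_neg hzx) (fun s => by
        by_cases hsx : s ≤ x
        · let := Fintype.ofFinite (Set.Iic x)
          refine (sum_Iic x (fun y => V.bd y s (g y)) fun z hz => ?_).symm.trans
            ((Finset.sum_congr rfl fun z _ => ?_).trans (hk ⟨s, hsx⟩))
          · have : g z = 0 := dif_neg hz
            rw [this, map_zero]
          · rw [hg]
            rfl
        · refine Finset.sum_eq_zero fun z _ => ?_
          by_cases hzx : z ≤ x
          · rw [V.bd_eq_zero z s fun h => hsx (h.le.trans hzx), LinearMap.zero_apply]
          · have : g z = 0 := dif_neg hzx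
            rw [this, map_zero])
    exact ⟨v, fun z => (hv z.1).trans (hg z)⟩

/-- The interval below a greatest element is the whole poset with the same ranks, so cycles can be
reindexed to the interval, filled by the homotopy, and carried back. -/
theorem isAcyclic_of_top (hL : IsSemimodular L) (x : L) (hx : ∀ y, y ≤ x)
    (h : Nonempty (LHomotopy (V.below x))) : V.IsAcyclic := by
  intro i
  refine le_antisymm (fun v hv => ?_) ?_
  · obtain ⟨h⟩ := h
    have hrk := hL.rk_coe x
    have hsum : ∀ (j : ℕ) (s : V.chain (j + 1)) (y : {y : Set.Iic x // rk y = j}),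
        (V.below x).d j (fun y => s ⟨y.1.1, (hrk y.1).symm.trans y.2⟩) y =
          V.d j s ⟨y.1.1, (hrk y.1).symm.trans y.2⟩ := by
      intro j s y
      let := Fintype.ofFinite (Set.Iic x)
      refine (Mat.toChain_apply (V := V.below x) (V.below x).bd (j + 1) j _ y).trans
        (Eq.trans ?_ (Mat.toChain_apply (V := V) V.bd (j + 1) j s
          ⟨y.1.1, (hrk y.1).symm.trans y.2⟩).symm)
      refine Fintype.sum_bijective (M := V.piece y.1.1) (fun z : {z : Set.Iic x // rk z = j + 1} =>
        (⟨z.1.1, (hrk z.1).symm.trans z.2⟩ : {z : L // rk z = j + 1})) ⟨?_, ?_⟩ _ _ fun z => rfl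
      · intro z z' hz
        have h : z.1.1 = z'.1.1 := congrArg (fun t : {t : L // rk t = j + 1} => t.1) hz
        exact Subtype.ext (Subtype.ext h)
      · intro z
        exact ⟨⟨⟨z.1, hx z.1⟩, (hrk ⟨z.1, hx z.1⟩).trans z.2⟩, rfl⟩
    obtain ⟨t, ht⟩ := h.ker_le_range i (x := fun y => v ⟨y.1.1, (hrk y.1).symm.trans y.2⟩)
      (LinearMap.mem_ker.2 (funext fun y => (hsum i v y).trans
        (congrFun (LinearMap.mem_ker.1 hv) _)))
    refine ⟨fun y => t ⟨⟨y.1, hx y.1⟩, (hrk ⟨y.1, hx y.1⟩).trans y.2⟩, funext fun y => ?_⟩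
    have h1 := congrFun ht ⟨⟨y.1, hx y.1⟩, (hrk ⟨y.1, hx y.1⟩).trans y.2⟩
    rw [← h1]
    exact (hsum (i + 1) (fun y => t ⟨⟨y.1, hx y.1⟩, (hrk ⟨y.1, hx y.1⟩).trans y.2⟩)
      ⟨⟨y.1, hx y.1⟩, (hrk ⟨y.1, hx y.1⟩).trans y.2⟩).symm
  · rintro _ ⟨v, rfl⟩
    exact LinearMap.congr_fun (d_comp_d hL i) v

end

variable {R : Type w} [Ring R] {L : Type u} [PartialOrder L] [Finite L] [OrderBot L]
  {M : Type v} [AddCommGroup M] [Module R M] {V : GradedComplex.{u, max u v, w} R L}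
  {D : AtomicDatum R L M}

theorem IsMinimal.hasKernelPieces (hV : V.IsMinimal D) : V.HasKernelPieces where
  injective x hx v hv := by
    by_cases ha : IsAtom x
    · obtain ⟨e, he⟩ := hV.low
      obtain ⟨f, hf⟩ := he x ha
      have h := hf v
      rw [hv, map_zero] at h
      exact f.injective (by rw [map_zero]; exact Subtype.ext h.symm)
    · exact hV.injective x hx ha v hv
  exact := hV.exact

/-- Operators `δ a : M → U_a` whose sum over the atoms `a ≤ x` is the identity on these `U_a`, and
whose partial sums over the rank two elements preserve the `U_a`, yield an `L`-homotopy. -/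
theorem IsMinimal.exists_lHomotopy_below (hL : IsSemimodular L) (hV : V.IsMinimal D) (x : L)
    (δ : L → M →ₗ[R] M) (hδ : ∀ a (ha : IsAtom a) u, δ a u ∈ D.sub a ha)
    (hid : ∀ a (ha : IsAtom a), a ≤ x → ∀ u ∈ D.sub a ha,
      ∑ w : L, (if IsAtom w ∧ w ≤ x then δ w u else 0) = u)
    (hloc : ∀ a z (ha : IsAtom a), a ⋖ z → z ≤ x → ∀ u ∈ D.sub a ha,
      ∑ w : L, (if IsAtom w ∧ w ≤ z then δ w u else 0) ∈ D.sub a ha) :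
    Nonempty (LHomotopy (V.below x)) := by
  obtain ⟨e, he⟩ := hV.low
  choose f hf using he
  let k : ∀ w : Set.Iic x, V.piece ⊥ →ₗ[R] V.piece w.1 := fun w =>
    if hw : IsAtom w.1 then
      (f w.1 hw).symm.toLinearMap ∘ₗ (δ w.1).codRestrict _ (hδ w.1 hw) ∘ₗ e.toLinearMap
    else 0
  have hk : ∀ (w : Set.Iic x) u, e (V.bd w.1 ⊥ (k w u)) = if IsAtom w.1 then δ w.1 (e u) else 0 := by
    intro w u
    by_cases hw : IsAtom w.1
    · rw [if_pos hw, hf w.1 hw]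
      simp [k, hw]
    · simp [k, hw]
  have hmem : ∀ (a : L) (ha : IsAtom a) (v : V.piece a), e (V.bd a ⊥ v) ∈ D.sub a ha :=
    fun a ha v => by
      rw [hf a ha v]
      exact (f a ha v).2
  refine exists_lHomotopy (V := V.below x) (hL.Iic x) (hV.hasKernelPieces.below x) k
    (fun w hw => dif_neg fun h => hw (isAtom_coe_iff.1 h)) (fun a ha v => ?_)
    (fun a z ha haz v => ?_)
  · have ha' := isAtom_coe_iff.2 ha
    let := Fintype.ofFinite (Set.Iic x)
    apply e.injective
    change e (∑ w ∈ @Finset.univ (Set.Iic x) (Fintype.ofFinite _), V.bd w.1 ⊥ (k w (V.bd a.1 ⊥ v))) = e (V.bd a.1 ⊥ v)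
    rw [map_sum]
    refine Eq.trans ?_ (hid a.1 ha' a.2 _ (hmem a.1 ha' v))
    rw [← sum_Iic x _ (fun y hy => if_neg fun h => hy h.2)]
    refine Finset.sum_congr rfl fun w _ => ?_
    rw [hk]
    have hwx : w.1 ≤ x := w.2
    simp [hwx]
  · have ha' := isAtom_coe_iff.2 ha
    let := Fintype.ofFinite (Set.Iic x)
    have hm := hloc a.1 z.1 ha' (covBy_coe_iff.2 haz) z.2 _ (hmem a.1 ha' v)
    obtain ⟨c, hc⟩ := (f a.1 ha').surjective ⟨_, hm⟩
    refine ⟨c, ?_⟩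
    apply e.injective
    change e (∑ w ∈ @Finset.univ (Set.Iic x) (Fintype.ofFinite _), if w ⋖ z then V.bd w.1 ⊥ (k w (V.bd a.1 ⊥ v)) else 0) =
      e (V.bd a.1 ⊥ c)
    rw [hf a.1 ha', hc, map_sum]
    change _ = ∑ w : L, _
    rw [← sum_Iic x _ (fun y hy => if_neg fun h => hy (h.2.trans z.2))]
    refine Finset.sum_congr rfl fun w _ => ?_
    by_cases hw : IsAtom w.1
    · have : w ⋖ z ↔ w.1 ≤ z.1 := by
        refine ⟨fun h => h.le, fun h => covBy_of_rk h ?_⟩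
        have h1 := (hL.Iic x).rk_covBy _ _ haz
        have h2 := (hL.Iic x).rk_covBy _ _ (bot_covBy_iff.2 ha)
        have h3 := (hL.Iic x).rk_covBy _ _ (bot_covBy_iff.2 (isAtom_coe_iff.1 hw))
        omega
      by_cases hwz : w.1 ≤ z.1
      · rw [if_pos (this.2 hwz), if_pos ⟨hw, hwz⟩, hk, if_pos hw]
      · rw [if_neg fun h => hwz (this.1 h), if_neg fun h => hwz h.2, map_zero]
    · rw [if_neg fun h : IsAtom w.1 ∧ w.1 ≤ z.1 => hw h.1]
      by_cases hwz : w ⋖ z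
      · rw [if_pos hwz, hk, if_neg hw]
      · rw [if_neg hwz, map_zero]

end GradedComplex

end LGraded

/-! ### Semimodularity of the intersection lattice -/

namespace HyperplaneArrangement

open LGraded Module

variable {K : Type w} {W : Type v} [Field K] [AddCommGroup W] [Module K W]
  {A : HyperplaneArrangement K W}

/-- The join of two elements of the intersection lattice is their intersection. -/
theorem exists_inf (X Y : A.IntersectionLattice) :
    ∃ Z : A.IntersectionLattice, Z.space = X.space ⊓ Y.space := by
  obtain ⟨X, B, hB, hX⟩ := X
  obtain ⟨Y, C, hC, hY⟩ := Y
  refine ⟨⟨OrderDual.toDual (sInf (B ∪ C)), B ∪ C, Set.union_subset hB hC, rfl⟩, ?_⟩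
  change sInf (B ∪ C) = OrderDual.ofDual X ⊓ OrderDual.ofDual Y
  rw [sInf_union, ← hX, ← hY]

/-- A hyperplane of the arrangement as an element of the intersection lattice. -/
def ofHyperplane (H : Submodule K W) (hH : H ∈ A.hyperplanes) : A.IntersectionLattice :=
  ⟨OrderDual.toDual H, {H}, by simpa using hH, by simp⟩

theorem space_injective {X Y : A.IntersectionLattice} (h : X.space = Y.space) : X = Y :=
  Subtype.ext h

theorem exists_hyperplane_of_not_le (X : A.IntersectionLattice) {Y : Submodule K W}
    (h : ¬ Y ≤ X.space) : ∃ H ∈ A.hyperplanes, X.space ≤ H ∧ ¬ Y ≤ H := by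
  obtain ⟨X, B, hB, hX⟩ := X
  change ¬ Y ≤ OrderDual.ofDual X at h
  change ∃ H ∈ A.hyperplanes, OrderDual.ofDual X ≤ H ∧ ¬ Y ≤ H
  rw [hX, le_sInf_iff] at h
  push Not at h
  obtain ⟨H, hH, hY⟩ := h
  exact ⟨H, hB hH, hX ▸ sInf_le hH, hY⟩

theorem isAtom_ofHyperplane (H : Submodule K W) (hH : H ∈ A.hyperplanes) :
    IsAtom (ofHyperplane H hH) := by
  have hc := A.isCoatom H hH
  refine ⟨fun h => hc.1 (congrArg IntersectionLattice.space h), fun Y hY => ?_⟩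
  exact space_injective (hc.2 Y.space (lt_of_le_of_ne hY.le fun h => hY.ne (space_injective h.symm)))

theorem exists_top (A : HyperplaneArrangement K W) : ∃ X : A.IntersectionLattice, ∀ Y, Y ≤ X :=
  ⟨⟨OrderDual.toDual (sInf A.hyperplanes), _, subset_rfl, rfl⟩, fun Y => by
    obtain ⟨B, hB, hY⟩ := Y.2
    change sInf A.hyperplanes ≤ OrderDual.ofDual Y.1
    rw [hY]
    exact sInf_le_sInf hB⟩

variable [FiniteDimensional K W]

theorem finrank_inf_of_isCoatom {H Y : Submodule K W} (hH : IsCoatom H) (h : ¬ Y ≤ H) :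
    finrank K Y = finrank K (Y ⊓ H : Submodule K W) + 1 := by
  have h1 := Submodule.finrank_sup_add_finrank_inf_eq Y H
  have hsup : Y ⊔ H = ⊤ := hH.2 _ (right_lt_sup.2 h)
  have h2 := Submodule.finrank_quotient_add_finrank H
  have : IsSimpleModule K (W ⧸ H) := isSimpleModule_iff_isCoatom.2 hH
  have h3 : finrank K (W ⧸ H) = 1 := by
    exact isSimpleModule_iff_finrank_eq_one.1 this
  rw [hsup, finrank_top] at h1
  omega

/-- Cut `Y` with a hyperplane of the arrangement that contains `X` but not `Y`: the result lies
between `Y` and `X`, so it is `X`. -/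
theorem finrank_covBy {Y X : A.IntersectionLattice} (h : Y ⋖ X) :
    finrank K Y.space = finrank K X.space + 1 := by
  obtain ⟨H, hH, hX, hY⟩ := exists_hyperplane_of_not_le X (Y := Y.space) h.lt.not_ge
  obtain ⟨Z, hZ⟩ := exists_inf Y (ofHyperplane H hH)
  have hZ' : Z.space = Y.space ⊓ H := hZ
  have : Z = X := by
    refine (h.eq_or_eq (c := Z) ?_ ?_).resolve_left ?_
    · rw [le_iff, hZ']
      exact inf_le_left
    · rw [le_iff, hZ']
      exact le_inf h.le hX
    · rintro rfl
      exact hY (hZ' ▸ inf_le_right)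
  rw [← this, hZ']
  exact finrank_inf_of_isCoatom (A.isCoatom H hH) hY

theorem covBy_of_finrank {Y X : A.IntersectionLattice} (h : Y ≤ X)
    (hr : finrank K Y.space = finrank K X.space + 1) : Y ⋖ X := by
  have hmono : ∀ {S T : A.IntersectionLattice}, S < T → finrank K T.space < finrank K S.space :=
    fun {S T} hST => Submodule.finrank_lt_finrank_of_lt
      (lt_of_le_of_ne hST.le fun h' => hST.ne (space_injective h'.symm))
  refine ⟨lt_of_le_of_ne h (by rintro rfl; omega), fun C h1 h2 => ?_⟩
  have := hmono h1
  have := hmono h2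
  omega

/-- Rank is codimension and joins are intersections. If `S` covers `Y`, then `S = Y ⊓ H` for one
hyperplane, so a second cover `T` meets `S` in `T ⊓ H`, of codimension one in both. -/
theorem isSemimodular (A : HyperplaneArrangement K W) : IsSemimodular A.IntersectionLattice where
  rk_covBy := by
    have hle : ∀ X : A.IntersectionLattice, finrank K X.space ≤ finrank K W :=
      fun X => Submodule.finrank_le _
    have hrk := rk_eq_of_covBy (fun X : A.IntersectionLattice => finrank K W - finrank K X.space)
      (by
        change finrank K W - finrank K (⊤ : Submodule K W) = 0
        rw [finrank_top, Nat.sub_self]) (fun Y X h => by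
        have h1 := finrank_covBy h
        have h2 := hle Y
        change finrank K W - finrank K X.space = finrank K W - finrank K Y.space + 1
        omega)
    intro Y X h
    have h1 := finrank_covBy h
    have h2 := hle Y
    rw [hrk, hrk]
    omega
  exists_join Y S T hS hT hne := by
    obtain ⟨Z, hZ⟩ := exists_inf S T
    have hST : ¬ T.space ≤ S.space := fun h => by
      have h1 := finrank_covBy hS
      have h2 := finrank_covBy hT
      exact hne (space_injective (Submodule.eq_of_le_of_finrank_eq h (by omega)).symm)
    obtain ⟨H, hH, hSH, hTH⟩ := exists_hyperplane_of_not_le S hST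
    have hSY : S.space = Y.space ⊓ H := by
      refine Submodule.eq_of_le_of_finrank_eq (le_inf hS.le hSH) ?_
      have h1 := finrank_covBy hS
      have h2 := finrank_inf_of_isCoatom (A.isCoatom H hH) (Y := Y.space) fun h =>
        hTH (le_trans hT.le h)
      omega
    have hZ' : Z.space = T.space ⊓ H := by
      have : T.space ≤ Y.space := hT.le
      rw [hZ, hSY, inf_right_comm, inf_eq_right.2 this]
    have hd := finrank_inf_of_isCoatom (A.isCoatom H hH) hTH
    rw [← hZ'] at hd
    have h1 := finrank_covBy hS
    have h2 := finrank_covBy hT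
    refine ⟨Z, covBy_of_finrank ?_ (by omega), covBy_of_finrank ?_ hd, fun U h h' => ?_⟩
    · rw [le_iff, hZ]
      exact inf_le_left
    · rw [le_iff, hZ]
      exact inf_le_right
    · rw [le_iff, hZ]
      exact le_inf h h'
  eq_or_le X Z Z' U hZ hZ' hU hU' := by
    obtain ⟨J, hJ⟩ := exists_inf X U
    have hXJ : X ≤ J := by
      rw [le_iff, hJ]
      exact inf_le_left
    have hUJ : U ≤ J := by
      rw [le_iff, hJ]
      exact inf_le_right
    have h : ∀ S : A.IntersectionLattice, X ≤ S → U ≤ S → J ≤ S := fun S h h' => by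
      rw [le_iff, hJ]
      exact le_inf h h'
    rcases hZ.eq_or_eq hXJ (h Z hZ.le hU) with rfl | rfl
    · exact Or.inr hUJ
    rcases hZ'.eq_or_eq hXJ (h Z' hZ'.le hU') with rfl | rfl
    · exact Or.inr hUJ
    · exact Or.inl rfl

end HyperplaneArrangement
-- Two facts of linear algebra
/-- An operator preserving `S` and injective on it has a linear inverse on all its invariant
subspaces contained in `S`. -/
theorem LinearMap.exists_inverse_on_invariant {K : Type*} {M : Type*} [Field K] [AddCommGroup M]
    [Module K M] [FiniteDimensional K M] (T : M →ₗ[K] M) (S : Submodule K M)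
    (hS : ∀ u ∈ S, T u ∈ S) (hinj : ∀ u ∈ S, T u = 0 → u = 0) :
    ∃ J : M →ₗ[K] M, ∀ N ≤ S, (∀ u ∈ N, T u ∈ N) → ∀ u ∈ N, J u ∈ N ∧ T (J u) = u := by
  have hbij : ∀ N ≤ S, ∀ hN : (∀ u ∈ N, T u ∈ N), Function.Bijective (T.restrict hN) := by
    intro N hNS hN
    have : Function.Injective (T.restrict hN) := by
      rw [← LinearMap.ker_eq_bot, LinearMap.ker_eq_bot']
      intro u hu
      exact Subtype.ext (hinj u.1 (hNS u.2) (congrArg Subtype.val hu))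
    exact ⟨this, LinearMap.injective_iff_surjective.1 this⟩
  let E := LinearEquiv.ofBijective (T.restrict hS) (hbij S le_rfl hS)
  obtain ⟨p, hp⟩ := LinearMap.exists_leftInverse_of_injective S.subtype S.ker_subtype
  refine ⟨S.subtype ∘ₗ E.symm.toLinearMap ∘ₗ p, fun N hNS hN u hu => ?_⟩
  have hpu : p u = ⟨u, hNS hu⟩ := LinearMap.congr_fun hp ⟨u, hNS hu⟩
  -- By finite dimension `T` is already onto `N`, so the unique preimage in `S` lies in `N`.
  obtain ⟨s, hs⟩ := (hbij N hNS hN).2 ⟨u, hu⟩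
  have hTs : T s.1 = u := congrArg Subtype.val hs
  have hs' : E ⟨s.1, hNS s.2⟩ = ⟨u, hNS hu⟩ := Subtype.ext hTs
  have hJ : (S.subtype ∘ₗ E.symm.toLinearMap ∘ₗ p) u = s.1 := by
    simp [hpu, ← hs']
  rw [hJ]
  exact ⟨s.2, hTs⟩

/-- An operator whose kernel meets its range trivially: a functional that vanishes on both is
zero. -/
theorem LinearMap.eq_zero_of_comp_eq_zero {K : Type*} {M : Type*} [Field K] [AddCommGroup M]
    [Module K M] [FiniteDimensional K M] (p : M →ₗ[K] M) (hp : ∀ v, p (p v) = 0 → p v = 0)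
    (u : Module.Dual K M) (hu : ∀ v, p v = 0 → u v = 0) (hu' : ∀ v, u (p v) = 0) : u = 0 := by
  have hdis : Disjoint (LinearMap.ker p) (LinearMap.range p) := by
    rw [Submodule.disjoint_def]
    rintro _ h ⟨v, rfl⟩
    exact hp v h
  have htop : LinearMap.ker p ⊔ LinearMap.range p = ⊤ := by
    apply Submodule.eq_top_of_disjoint _ _ _ hdis
    rw [add_comm, LinearMap.finrank_range_add_finrank_ker]
  ext v
  have hv : v ∈ LinearMap.ker p ⊔ LinearMap.range p := htop ▸ Submodule.mem_top
  obtain ⟨a, ha, _, ⟨b, rfl⟩, rfl⟩ := Submodule.mem_sup.1 hv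
  rw [map_add, hu a ha, hu' b, add_zero, LinearMap.zero_apply]

/-! ### Sums over reflections fixing a flat -/

namespace ReflectionArrangement

open LGraded HyperplaneArrangement

attribute [local instance] Fintype.ofFinite

variable {V : Type v} [AddCommGroup V] [Module ℂ V] (G : Subgroup (V ≃ₗ[ℂ] V))

/-- The real part of a Hermitian inner product, summed over the group. Additivity, symmetry and
definiteness are all that is used later. -/
theorem exists_invariant_form [FiniteDimensional ℂ V] [Finite G] :
    ∃ B : V →+ V →+ ℝ, (∀ v, 0 ≤ B v v) ∧ (∀ v, B v v = 0 → v = 0) ∧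
      (∀ v w, B v w = B w v) ∧ ∀ g ∈ G, ∀ v w, B (g v) (g w) = B v w := by
  let φ : V ≃ₗ[ℂ] EuclideanSpace ℂ (Fin (Module.finrank ℂ V)) :=
    LinearEquiv.ofFinrankEq _ _ (by simp)
  let f : V → V → ℝ := fun v w => ∑ g : G, (inner ℂ (φ (g.1 v)) (φ (g.1 w))).re
  let B : V →+ V →+ ℝ := AddMonoidHom.mk'
    (fun v => AddMonoidHom.mk' (f v) fun w w' => by
      simp [f, Finset.sum_add_distrib])
    fun v v' => by
      ext w
      simp [f, Finset.sum_add_distrib]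
  have hB : ∀ v w, B v w = ∑ g : G, (inner ℂ (φ (g.1 v)) (φ (g.1 w))).re := fun _ _ => rfl
  have hnn : ∀ v, ∀ g : G, 0 ≤ (inner ℂ (φ (g.1 v)) (φ (g.1 v))).re :=
    fun v g => inner_self_nonneg (𝕜 := ℂ)
  refine ⟨B, fun v => ?_, fun v hv => ?_, fun v w => ?_, fun h hh v w => ?_⟩
  · rw [hB]
    exact Finset.sum_nonneg fun g _ => hnn v g
  · rw [hB, Finset.sum_eq_zero_iff_of_nonneg fun g _ => hnn v g] at hv
    have h1 := hv 1 (Finset.mem_univ _)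
    have h2 : φ v = 0 := by
      rw [← inner_self_eq_zero (𝕜 := ℂ)]
      apply Complex.ext
      · exact h1
      · exact inner_self_im (𝕜 := ℂ) _
    simpa using h2
  · rw [hB, hB]
    exact Finset.sum_congr rfl fun g _ => inner_re_symm (𝕜 := ℂ) _ _
  · rw [hB, hB]
    exact Fintype.sum_equiv (Equiv.mulRight (⟨h, hh⟩ : G)) _ _ fun g => rfl

/-- The reflections in `G` that fix the subspace `z` pointwise. -/
def Fixes (z : Submodule ℂ V) (g : V ≃ₗ[ℂ] V) : Prop :=
  g ∈ G ∧ IsComplexReflection g ∧ z ≤ LinearMap.fixedSubmodule (g : V →ₗ[ℂ] V)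

variable {G}

theorem Fixes.apply {z : Submodule ℂ V} {g : V ≃ₗ[ℂ] V} (h : Fixes G z g) {v : V} (hv : v ∈ z) :
    g v = v :=
  LinearMap.mem_fixedSubmodule_iff.1 (h.2.2 hv)

theorem Fixes.mono {y z : Submodule ℂ V} (hzy : z ≤ y) {g : V ≃ₗ[ℂ] V} (h : Fixes G y g) :
    Fixes G z g :=
  ⟨h.1, h.2.1, hzy.trans h.2.2⟩

theorem isComplexReflection_conj {g : V ≃ₗ[ℂ] V} (h : V ≃ₗ[ℂ] V) (hg : IsComplexReflection g) :
    IsComplexReflection (h * g * h⁻¹) := by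
  refine ⟨?_, ?_⟩
  · obtain ⟨n, hn, hgn⟩ := isOfFinOrder_iff_pow_eq_one.1 hg.1
    exact isOfFinOrder_iff_pow_eq_one.2 ⟨n, hn, by rw [conj_pow, hgn]; group⟩
  · have : LinearMap.fixedSubmodule ((h * g * h⁻¹ : V ≃ₗ[ℂ] V) : V →ₗ[ℂ] V) =
        Submodule.orderIsoMapComap h (LinearMap.fixedSubmodule (g : V →ₗ[ℂ] V)) := by
      ext v
      rw [LinearMap.mem_fixedSubmodule_iff]
      change h (g (h.symm v)) = v ↔ v ∈ Submodule.map (h : V →ₗ[ℂ] V) _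
      rw [Submodule.mem_map_equiv, LinearMap.mem_fixedSubmodule_iff, ← LinearEquiv.eq_symm_apply]
      rfl
    rw [this, OrderIso.isCoatom_iff]
    exact hg.2

theorem fixes_conj {z : Submodule ℂ V} {g h : V ≃ₗ[ℂ] V} (hh : h ∈ G) (hz : ∀ v ∈ z, h v = v)
    (hg : Fixes G z g) : Fixes G z (h * g * h⁻¹) := by
  refine ⟨G.mul_mem (G.mul_mem hh hg.1) (G.inv_mem hh), isComplexReflection_conj h hg.2.1,
    fun v hv => ?_⟩
  rw [LinearMap.mem_fixedSubmodule_iff]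
  change h (g (h.symm v)) = v
  have : h.symm v = v := by
    rw [LinearEquiv.symm_apply_eq, hz v hv]
  rw [this, hg.apply hv, hz v hv]

variable [Finite G]

/-- The sum of `1 - g` over the reflections `g` that fix `z` pointwise. -/
def reflSum (G : Subgroup (V ≃ₗ[ℂ] V)) [Finite G] (z : Submodule ℂ V) : V →ₗ[ℂ] V :=
  ∑ g : G, if Fixes G z g then LinearMap.id - (g.1 : V →ₗ[ℂ] V) else 0

theorem reflSum_apply (z : Submodule ℂ V) (v : V) :
    reflSum G z v = ∑ g : G, if Fixes G z g then v - g.1 v else 0 := by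
  rw [reflSum, LinearMap.sum_apply]
  refine Finset.sum_congr rfl fun g _ => ?_
  split_ifs <;> simp

/-- Conjugation by `h` permutes the reflections that fix `z`. -/
theorem apply_reflSum {z : Submodule ℂ V} {h : V ≃ₗ[ℂ] V} (hh : Fixes G z h) (v : V) :
    h (reflSum G z v) = reflSum G z (h v) := by
  rw [reflSum_apply, reflSum_apply, map_sum]
  refine Fintype.sum_equiv (MulAut.conj (⟨h, hh.1⟩ : G)).toEquiv _ _ fun g => ?_
  have hc : ((MulAut.conj (⟨h, hh.1⟩ : G)).toEquiv g).1 = h * g.1 * h⁻¹ := rfl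
  have hiff : Fixes G z (h * g.1 * h⁻¹) ↔ Fixes G z g.1 := by
    refine ⟨fun hg => ?_, fixes_conj hh.1 fun v hv => hh.apply hv⟩
    have := fixes_conj (h := h⁻¹) (G.inv_mem hh.1) (fun v hv => by
      change h.symm v = v
      rw [LinearEquiv.symm_apply_eq, hh.apply hv]) hg
    convert this using 1
    group
  rw [hc]
  by_cases hg : Fixes G z g.1
  · rw [if_pos hg, if_pos (hiff.2 hg), map_sub]
    congr 1
    change _ = h (g.1 (h.symm (h v)))
    rw [LinearEquiv.symm_apply_apply]
  · rw [if_neg hg, if_neg (hiff.not.2 hg), map_zero]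

/-- The subspaces that are intersections of reflecting hyperplanes. -/
def IsFlat (G : Subgroup (V ≃ₗ[ℂ] V)) (y : Submodule ℂ V) : Prop :=
  ∀ v, (∀ g, Fixes G y g → g v = v) → v ∈ y

/-- Every reflection fixing `y` also fixes `z`, so it commutes with the sum and fixes the image of
`v`; a flat contains all such vectors. -/
theorem reflSum_mem {y z : Submodule ℂ V} (hy : IsFlat G y) (hzy : z ≤ y) {v : V} (hv : v ∈ y) :
    reflSum G z v ∈ y :=
  hy _ fun g hg => by rw [apply_reflSum (hg.mono hzy), hg.apply hv]

/-- Invariance gives 2 B(v, v - gv) = B(v - gv, v - gv) ≥ 0. Pairing the sum with `v` therefore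
forces every `v - gv` to vanish. -/
theorem mem_of_reflSum_eq_zero [FiniteDimensional ℂ V] {z : Submodule ℂ V} (hz : IsFlat G z) {v : V}
    (hv : reflSum G z v = 0) : v ∈ z := by
  obtain ⟨B, hnn, hdef, hsymm, hinv⟩ := exists_invariant_form G
  have h2 : ∀ g ∈ G, 2 * B v (v - g v) = B (v - g v) (v - g v) := by
    intro g hg
    have h1 := hinv g hg v v
    have h3 := hsymm v (g v)
    simp only [map_sub, AddMonoidHom.sub_apply]
    linarith
  have hsum : ∑ g : G, (if Fixes G z g then B (v - g.1 v) (v - g.1 v) else 0) = 0 := by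
    have h1 : B v (reflSum G z v) = 0 := by rw [hv, map_zero]
    rw [reflSum_apply, map_sum] at h1
    calc _ = 2 * ∑ g : G, B v (if Fixes G z g then v - g.1 v else 0) := by
            rw [Finset.mul_sum]
            refine Finset.sum_congr rfl fun g _ => ?_
            split_ifs
            · rw [h2 g.1 g.2]
            · rw [map_zero, mul_zero]
      _ = 0 := by rw [h1, mul_zero]
  rw [Finset.sum_eq_zero_iff_of_nonneg fun g _ => by split_ifs; exacts [hnn _, le_rfl]] at hsum
  refine hz v fun g hg => ?_
  have := hsum ⟨g, hg.1⟩ (Finset.mem_univ _)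
  rw [if_pos hg] at this
  exact (sub_eq_zero.1 (hdef _ this)).symm

/-- The image is orthogonal to `z`, since B(w, v - gv) = 0 whenever `g` fixes `w`. -/
theorem reflSum_eq_zero_of_mem [FiniteDimensional ℂ V] {z : Submodule ℂ V} {v : V} (hv : reflSum G z v ∈ z) :
    reflSum G z v = 0 := by
  obtain ⟨B, -, hdef, -, hinv⟩ := exists_invariant_form G
  have h : ∀ w ∈ z, B w (reflSum G z v) = 0 := by
    intro w hw
    rw [reflSum_apply, map_sum]
    refine Finset.sum_eq_zero fun g _ => ?_
    split_ifs with hg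
    · rw [map_sub, ← hinv g.1 g.2 w v, hg.apply hw, sub_self]
    · rw [map_zero]
  exact hdef _ (h _ hv)

theorem isFlat_space (X : (reflectionArrangement G).IntersectionLattice) : IsFlat G X.space := by
  intro v hv
  by_contra h
  obtain ⟨H, ⟨g, hg, hr, rfl⟩, hX, hvH⟩ := exists_hyperplane_of_not_le X
    (Y := Submodule.span ℂ {v}) (by rwa [Submodule.span_singleton_le_iff_mem])
  rw [Submodule.span_singleton_le_iff_mem, LinearMap.mem_fixedSubmodule_iff] at hvH
  exact hvH (hv g ⟨hg, hr, hX⟩)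

/-! ### Restriction to `X` and the operators attached to atoms -/

variable (X : (reflectionArrangement G).IntersectionLattice)

/-- An element of the intersection lattice of the restriction, as a subspace of `V`. -/
def toAmbient (a : ((reflectionArrangement G).restriction X).IntersectionLattice) :
    Submodule ℂ V :=
  a.space.map X.space.subtype

variable {X} (a z : ((reflectionArrangement G).restriction X).IntersectionLattice)

theorem toAmbient_le : toAmbient X a ≤ X.space := Submodule.map_subtype_le _ _

theorem mem_toAmbient (v : X.space) : v.1 ∈ toAmbient X a ↔ v ∈ a.space := by
  simp [toAmbient]

variable {a z} in
theorem toAmbient_mono (h : a ≤ z) : toAmbient X z ≤ toAmbient X a :=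
  Submodule.map_mono h

theorem isFlat_toAmbient : IsFlat G (toAmbient X a) := by
  intro v hv
  have hvX : v ∈ X.space := isFlat_space X v fun g hg => hv g (hg.mono (toAmbient_le a))
  rw [mem_toAmbient a ⟨v, hvX⟩]
  by_contra h
  obtain ⟨H, ⟨_, ⟨g, hg, hr, rfl⟩, -, rfl⟩, hX, hvH⟩ := exists_hyperplane_of_not_le a
    (Y := Submodule.span ℂ {⟨v, hvX⟩}) (by rwa [Submodule.span_singleton_le_iff_mem])
  rw [Submodule.span_singleton_le_iff_mem, Submodule.mem_comap,
    LinearMap.mem_fixedSubmodule_iff] at hvH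
  exact hvH (hv g ⟨hg, hr, Submodule.map_le_iff_le_comap.2 hX⟩)

/-- The restriction of `reflSum` to `X`. -/
def restrictedSum : X.space →ₗ[ℂ] X.space :=
  (reflSum G (toAmbient X z)).restrict fun _ => reflSum_mem (isFlat_space X) (toAmbient_le z)

variable {a z} in
theorem restrictedSum_mem (h : a ≤ z) {v : X.space} (hv : v ∈ a.space) :
    restrictedSum z v ∈ a.space := by
  rw [← mem_toAmbient] at hv ⊢
  exact reflSum_mem (isFlat_toAmbient a) (toAmbient_mono h) hv

theorem mem_of_restrictedSum_eq_zero [FiniteDimensional ℂ V] {v : X.space} (hv : restrictedSum z v = 0) : v ∈ z.space := by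
  rw [← mem_toAmbient]
  exact mem_of_reflSum_eq_zero (isFlat_toAmbient z) (congrArg Subtype.val hv)

theorem restrictedSum_eq_zero_of_mem [FiniteDimensional ℂ V] {v : X.space} (hv : restrictedSum z v ∈ z.space) :
    restrictedSum z v = 0 := by
  rw [← mem_toAmbient] at hv
  exact Subtype.ext (reflSum_eq_zero_of_mem hv)

variable {a z} in
theorem dualMap_restrictedSum_mem (h : a ≤ z) {u : Module.Dual ℂ X.space}
    (hu : u ∈ a.space.dualAnnihilator) :
    (restrictedSum z).dualMap u ∈ a.space.dualAnnihilator := by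
  rw [Submodule.mem_dualAnnihilator] at hu ⊢
  exact fun v hv => hu _ (restrictedSum_mem h hv)

/-- The functional kills `z`, hence the kernel of the sum, and by hypothesis its image. These two
are complementary because the image meets `z` trivially. -/
theorem dualMap_restrictedSum_injOn [FiniteDimensional ℂ V] {u : Module.Dual ℂ X.space}
    (hu : u ∈ z.space.dualAnnihilator) (h : (restrictedSum z).dualMap u = 0) : u = 0 := by
  rw [Submodule.mem_dualAnnihilator] at hu
  refine LinearMap.eq_zero_of_comp_eq_zero (restrictedSum z) (fun v hv => ?_) u
    (fun v hv => hu v (mem_of_restrictedSum_eq_zero z hv)) (fun v => LinearMap.congr_fun h v)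
  exact restrictedSum_eq_zero_of_mem z (mem_of_restrictedSum_eq_zero z hv)

/-- The contribution to `restrictedSum` of the reflections whose hyperplanes meet `X` in `a`,
transposed. -/
def atomPart (π : V →ₗ[ℂ] X.space) : Module.Dual ℂ X.space →ₗ[ℂ] Module.Dual ℂ X.space :=
  ∑ g : G, if IsComplexReflection g.1 ∧ ¬ X.space ≤ LinearMap.fixedSubmodule (g.1 : V →ₗ[ℂ] V) ∧
      (LinearMap.fixedSubmodule (g.1 : V →ₗ[ℂ] V)).comap X.space.subtype = a.space then
    (π ∘ₗ (LinearMap.id - (g.1 : V →ₗ[ℂ] V)) ∘ₗ X.space.subtype).dualMap else 0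

theorem atomPart_mem (π : V →ₗ[ℂ] X.space) (u : Module.Dual ℂ X.space) :
    atomPart a π u ∈ a.space.dualAnnihilator := by
  rw [atomPart, LinearMap.sum_apply]
  refine Submodule.sum_mem _ fun g _ => ?_
  split_ifs with hg
  · rw [Submodule.mem_dualAnnihilator]
    intro v hv
    rw [← hg.2.2, Submodule.mem_comap, LinearMap.mem_fixedSubmodule_iff] at hv
    have hv' : g.1 v.1 = v.1 := hv
    simp [hv']
  · exact zero_mem _

/-- Reflections fixing `X` contribute nothing; each of the others that fixes `z` belongs to exactly
one atom `a ≤ z`. A single `1 - g` need not map `X` into itself, hence the projection `π`; the whole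
sum does, so there `π` has no effect. -/
theorem sum_atomPart (π : V →ₗ[ℂ] X.space) (hπ : ∀ v : X.space, π v = v)
    (u : Module.Dual ℂ X.space) :
    ∑ a, (if IsAtom a ∧ a ≤ z then atomPart a π u else 0) = (restrictedSum z).dualMap u := by
  let N : G → X.space →ₗ[ℂ] X.space := fun g =>
    π ∘ₗ (LinearMap.id - (g.1 : V →ₗ[ℂ] V)) ∘ₗ X.space.subtype
  have h1 : ∀ g : G, ∑ a, (if IsAtom a ∧ a ≤ z then (if IsComplexReflection g.1 ∧
      ¬ X.space ≤ LinearMap.fixedSubmodule (g.1 : V →ₗ[ℂ] V) ∧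
      (LinearMap.fixedSubmodule (g.1 : V →ₗ[ℂ] V)).comap X.space.subtype = a.space then
      (N g).dualMap u else 0) else 0) =
      if Fixes G (toAmbient X z) g.1 then (N g).dualMap u else 0 := by
    intro g
    by_cases hX : X.space ≤ LinearMap.fixedSubmodule (g.1 : V →ₗ[ℂ] V)
    · have hN : (N g).dualMap u = 0 := by
        ext v
        have hv : g.1 v.1 = v.1 := LinearMap.mem_fixedSubmodule_iff.1 (hX v.2)
        simp [N, hv]
      simp [hN]
    by_cases hr : IsComplexReflection g.1
    · have hmem : (LinearMap.fixedSubmodule (g.1 : V →ₗ[ℂ] V)).comap X.space.subtype ∈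
          ((reflectionArrangement G).restriction X).hyperplanes :=
        ⟨_, ⟨g.1, g.2, hr, rfl⟩, hX, rfl⟩
      rw [Finset.sum_eq_single (ofHyperplane _ hmem)]
      · have hle : ofHyperplane _ hmem ≤ z ↔ Fixes G (toAmbient X z) g.1 :=
          ⟨fun h => ⟨g.2, hr, Submodule.map_le_iff_le_comap.2 h⟩,
            fun h => Submodule.map_le_iff_le_comap.1 h.2.2⟩
        have hsp : (LinearMap.fixedSubmodule (g.1 : V →ₗ[ℂ] V)).comap X.space.subtype =
          (ofHyperplane _ hmem).space := rfl
        rw [if_pos (⟨hr, hX, hsp⟩ : _ ∧ _ ∧ _)]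
        exact if_congr (by rw [hle, and_iff_right (isAtom_ofHyperplane _ hmem)]) rfl rfl
      · intro a _ ha
        rw [if_neg (c := _ ∧ _ ∧ _) fun h => ha (space_injective h.2.2.symm), ite_self]
      · exact fun h => absurd (Finset.mem_univ _) h
    · rw [if_neg fun h : Fixes G (toAmbient X z) g.1 => hr h.2.1]
      refine Finset.sum_eq_zero fun a _ => ?_
      rw [if_neg (c := _ ∧ _ ∧ _) fun h => hr h.1, ite_self]
  have h2 : ∀ a, (if IsAtom a ∧ a ≤ z then atomPart a π u else 0) = ∑ g : G,
      (if IsAtom a ∧ a ≤ z then (if IsComplexReflection g.1 ∧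
      ¬ X.space ≤ LinearMap.fixedSubmodule (g.1 : V →ₗ[ℂ] V) ∧
      (LinearMap.fixedSubmodule (g.1 : V →ₗ[ℂ] V)).comap X.space.subtype = a.space then
      (N g).dualMap u else 0) else 0) := by
    intro a
    split_ifs with ha
    · rw [atomPart, LinearMap.sum_apply]
      refine Finset.sum_congr rfl fun g _ => ?_
      split_ifs <;> rfl
    · simp
  rw [Finset.sum_congr rfl fun a _ => h2 a, Finset.sum_comm, Finset.sum_congr rfl fun g _ => h1 g]
  ext v
  have h3 : restrictedSum z v = ∑ g : G, if Fixes G (toAmbient X z) g.1 then N g v else 0 := by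
    rw [← hπ (restrictedSum z v)]
    change π (reflSum G (toAmbient X z) v.1) = _
    rw [reflSum_apply, map_sum]
    refine Finset.sum_congr rfl fun g _ => ?_
    split_ifs
    · rfl
    · rw [map_zero]
  rw [LinearMap.dualMap_apply, h3, map_sum, LinearMap.sum_apply]
  refine Finset.sum_congr rfl fun g _ => ?_
  split_ifs
  · rfl
  · rw [map_zero, LinearMap.zero_apply]

variable (X) in
theorem isLContractible_restriction [FiniteDimensional ℂ V] :
    ((reflectionArrangement G).restriction X).relationComplex.IsLContractible := by
  intro x
  obtain ⟨π, hπ⟩ := LinearMap.exists_leftInverse_of_injective X.space.subtype X.space.ker_subtype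
  have hπ' : ∀ v : X.space, π v = v := fun v => LinearMap.congr_fun hπ v
  -- A single inverse, on the annihilator of `x`, serves all lines below `x`, since each is
  -- invariant.
  obtain ⟨J, hJ⟩ := LinearMap.exists_inverse_on_invariant (restrictedSum x).dualMap
    x.space.dualAnnihilator (fun u hu => dualMap_restrictedSum_mem le_rfl hu)
    (fun u hu => dualMap_restrictedSum_injOn x hu)
  have hJ' : ∀ a ≤ x, ∀ u ∈ a.space.dualAnnihilator,
      J u ∈ a.space.dualAnnihilator ∧ (restrictedSum x).dualMap (J u) = u := fun a ha =>
    hJ a.space.dualAnnihilator (Submodule.dualAnnihilator_anti ha)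
      fun u hu => dualMap_restrictedSum_mem ha hu
  refine (minimalComplex_isMinimal _).exists_lHomotopy_below
    (isSemimodular ((reflectionArrangement G).restriction X)) x
    (fun a => atomPart a π ∘ₗ J) (fun a _ u => atomPart_mem a π _) (fun a ha hax u hu => ?_)
    (fun a z ha haz hzx u hu => ?_)
  · exact (sum_atomPart x π hπ' (J u)).trans (hJ' a hax u hu).2
  · have h := dualMap_restrictedSum_mem haz.le (hJ' a (haz.le.trans hzx) u hu).1
    rw [← sum_atomPart z π hπ'] at h
    exact h

end ReflectionArrangement
end

theorem mainTheorem2 {V : Type*} [AddCommGroup V] [Module ℂ V] [FiniteDimensional ℂ V]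
    (G : Subgroup (V ≃ₗ[ℂ] V)) [Finite G] (hG : IsComplexReflectionGroup G)
    (X : (reflectionArrangement G).IntersectionLattice) :
    ((reflectionArrangement G).restriction X).relationComplex.IsLContractible ∧
    ((reflectionArrangement G).restriction X).relationComplex.IsAcyclic ∧
    ((reflectionArrangement G).restriction X).relationComplex.IsFormal
      ((reflectionArrangement G).restriction X).rank := by
  have hc := ReflectionArrangement.isLContractible_restriction X
  obtain ⟨x, hx⟩ := HyperplaneArrangement.exists_top ((reflectionArrangement G).restriction X)
  have ha := LGraded.GradedComplex.isAcyclic_of_top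
    (HyperplaneArrangement.isSemimodular ((reflectionArrangement G).restriction X)) x hx (hc x)
  exact ⟨hc, ha, fun i _ => ha i⟩
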